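/- Let $G$ be a finite nonabelian $2$-group with Frattini subgroup $\operatorname{Fr}(G)$, and let $r$ be its Frattini rank, i.e. the rank of the elementary abelian group $G/\operatorname{Fr}(G)\cong(\mathbb Z/2)^r$. Let $K$ be a field containing a primitive $e$-th root of unity, where $$e=\min\{\exp(H)\;:\;H\text{ is a non-abelian subgroup of }G\}.$$ Let $a_1,\dots,a_r\in K^*$ and let $L=K(\sqrt{a_1},\dots,\sqrt{a_r})$ be a Galois extension of $K$ of degree $2^r$, with a fixed isomorphism $\varphi\colon\operatorname{Gal}(L/K)\to G/\operatorname{Fr}(G)$. Suppose that there exist a tower of fields $K\subset L\subset M$ with $M/K$ finite Galois and an isomorphism $\psi\colon\operatorname{Gal}(M/K)\to G$ such that $\varphi(\sigma|_L)=\psi(\sigma)\operatorname{Fr}(G)$ for all $\sigma\in\operatorname{Gal}(M/K)$. Then the $r$-fold Pfister form $$\ll a_1,\dots,a_r\gg\;=\;\langle 1,-a_1\rangle\otimes\cdots\otimes\langle 1,-a_r\rangle$$ is hyperbolic over $K$, i.e. isometric to an orthogonal sum of hyperbolic planes. -/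

import Mathlib

universe u₁ u₂ u₃ w

/-- The Frattini rank of a finite `2`-group `G`: the rank (minimal number of generators) of the
elementary abelian group `G / Fr(G)`. -/
noncomputable def frattiniRank (G : Type*) [Group G] [Finite G] : ℕ :=
  Group.rank (G ⧸ frattini G)

/-- The minimum of the exponents of the non-abelian subgroups of `G`. (For non-abelian `G` this is a
minimum over a non-empty set, as `G` itself is such a subgroup.) -/
noncomputable def minNonabelianExponent (G : Type*) [Group G] : ℕ :=
  sInf {e : ℕ | ∃ H : Subgroup G, (∃ x ∈ H, ∃ y ∈ H, x * y ≠ y * x) ∧ Monoid.exponent H = e}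

/-- `L = K(√a₁, …, √aᵣ)`: the extension `L` of `K` is generated by square roots of the `aᵢ`. -/
def IsGeneratedBySqrts (K L : Type*) [Field K] [Field L] [Algebra K L] {r : ℕ} (a : Fin r → Kˣ) :
    Prop :=
  ∃ s : Fin r → L, (∀ i, s i ^ 2 = algebraMap K L (a i)) ∧
    IntermediateField.adjoin K (Set.range s) = ⊤

/-- Solvability of the extension problem for `G`, `N` and the `G / N`-Galois extension `L / K` whose
Galois group is identified with `G / N` by `φ`: there is a tower `K ⊆ L ⊆ M` such that `M / K` is
Galois with group `G` (through `ψ`) and the restriction map `Gal(M/K) → Gal(L/K)` is the quotient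
map `G → G / N`. -/
def ExtensionProblemSolvable {G : Type u₁} [Group G] (N : Subgroup G) [N.Normal]
    (K : Type u₂) (L : Type u₃) [Field K] [Field L] [Algebra K L] [IsGalois K L]
    (φ : (L ≃ₐ[K] L) ≃* G ⧸ N) : Prop :=
  ∃ (M : Type w) (_ : Field M) (_ : Algebra K M) (_ : Algebra L M) (_ : IsScalarTower K L M),
    FiniteDimensional K M ∧ IsGalois K M ∧
      ∃ ψ : (M ≃ₐ[K] M) ≃* G, ∀ σ : M ≃ₐ[K] M,
        φ (AlgEquiv.restrictNormalHom L σ) = (ψ σ : G ⧸ N)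

/-- The `r`-fold Pfister form `≪a₁, …, aᵣ≫ = ⟨1, -a₁⟩ ⊗ ⋯ ⊗ ⟨1, -aᵣ⟩`. The tensor product of the
diagonal forms `⟨c i 0, c i 1⟩` is the diagonal form with coefficients `∏ i, c i (ε i)`, in the
basis of pure tensors indexed by `ε : Fin r → Fin 2`. -/
noncomputable def pfisterForm {K : Type*} [Field K] {r : ℕ} (a : Fin r → Kˣ) :
    QuadraticForm K ((Fin r → Fin 2) → K) :=
  QuadraticMap.weightedSumSquares K
    (fun ε : Fin r → Fin 2 => ∏ i, (![1, -(a i : K)] : Fin 2 → K) (ε i))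

/-- The hyperbolic plane: the form `(x, y) ↦ x * y` on `K × K`. -/
noncomputable def hyperbolicPlane (K : Type*) [Field K] : QuadraticForm K (K × K) :=
  QuadraticMap.linMulLin (LinearMap.fst K K K) (LinearMap.snd K K K)

/-- A quadratic form is hyperbolic if it is isometric to an orthogonal sum of finitely many
(possibly zero) hyperbolic planes. -/
def IsHyperbolicForm {K V : Type*} [Field K] [AddCommGroup V] [Module K V]
    (Q : QuadraticForm K V) : Prop :=
  ∃ n : ℕ, Q.Equivalent (QuadraticMap.pi (fun _ : Fin n => hyperbolicPlane K))

/-! The argument runs through the trace form `(x, y) ↦ Tr_{M/K}(x y)` on `M`. The degree `[M : K]`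
is a power of two and the characteristic is not two, so this form stays nondegenerate on the fixed
field of every subgroup. Since `Fr(G)` is generated by the squares, its fixed field is `L`. With `j²
= -1` in `K`, the square-free monomials in the elements `j√aᵢ` form an orthogonal basis of `L`, and
there the trace form is `[M : K]` times the Pfister form. It is therefore enough to find a
Lagrangian (a totally isotropic subspace of half the dimension) in `L`.

Two facts give it. First, the complement of `L` in `M` is metabolic. If `C / B` is the subgroup of
order two in a cyclic quotient of order four, Kummer theory with `j` gives a Lagrangian of the
complement of `M^C` in `M^B` (`IsFourStep.isMetabolicStep`), and a chain of such steps leads from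
`⊥` to the subgroup generated by the squares (`rel_bot_squareSubgroup`).

Second, `M` itself has a Lagrangian. Take a minimal non-abelian subgroup `H` inside one that
realises the exponent `e`. By the first fact applied to `H`, only the fixed field of the squares of
`H` matters. The roots of unity supply an element `c` there with `x c = -c` and `c · y c = 1`. Then
`(c + c⁻¹)² - (c - c⁻¹)² = 4`, and this relation makes a biquadratic trace form hyperbolic
(`exists_lagrangian_fixedSubmodule`).

Witt reduction (`exists_isotropic_of_isotropic`) cancels the complement and leaves a Lagrangian of
`L`. -/

open Module

/-! ### Lagrangians, Witt reduction and hyperbolic forms. -/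

section LinearAlgebra

variable {K V : Type*} [Field K] [AddCommGroup V] [Module K V] [FiniteDimensional K V]

/-- Witt reduction: if `W` is totally isotropic with orthogonal complement `W ⊕ N`, then a Lagrangian
of `V` yields a Lagrangian of `N`. -/
theorem exists_isotropic_of_isotropic (B : LinearMap.BilinForm K V) (hB : B.Nondegenerate)
    (hsymm : B.IsSymm) {U W N : Submodule K V}
    (hU : ∀ x ∈ U, ∀ y ∈ U, B x y = 0) (hUdim : finrank K V ≤ 2 * finrank K U)
    (hW : ∀ x ∈ W, ∀ y ∈ W, B x y = 0) (hWN : ∀ x ∈ W, ∀ y ∈ N, B x y = 0)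
    (hdisj : W ⊓ N = ⊥) (hdim : 2 * finrank K W + finrank K N = finrank K V) :
    ∃ U' ≤ N, (∀ x ∈ U', ∀ y ∈ U', B x y = 0) ∧ finrank K N ≤ 2 * finrank K U' := by
  have hsup : W ⊔ N = B.orthogonal W := by
    apply Submodule.eq_of_le_of_finrank_le
    · refine sup_le (fun x hx y hy => ?_) (fun x hx y hy => ?_)
      · exact hW y hy x hx
      · exact hWN y hy x hx
    · rw [LinearMap.BilinForm.finrank_orthogonal hB]
      have := Submodule.finrank_sup_add_finrank_inf_eq W N
      rw [hdisj, finrank_bot] at this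
      omega
  have hle : U ⊔ B.orthogonal W ≤ B.orthogonal (U ⊓ W) := by
    refine sup_le (fun x hx y hy => ?_) (fun x hx y hy => ?_)
    · exact hU y hy.1 x hx
    · exact hx y hy.2
  have h1 := Submodule.finrank_mono hle
  rw [LinearMap.BilinForm.finrank_orthogonal hB] at h1
  have h2 := Submodule.finrank_sup_add_finrank_inf_eq U (B.orthogonal W)
  rw [LinearMap.BilinForm.finrank_orthogonal hB] at h2
  have hUW : finrank K (U ⊓ W : Submodule K V) ≤ finrank K W := Submodule.finrank_mono inf_le_right
  set T := U ⊓ B.orthogonal W with hT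
  have h3 := Submodule.finrank_sup_add_finrank_inf_eq (T ⊔ W) N
  have h4 := Submodule.finrank_sup_add_finrank_inf_eq T W
  have h5 : finrank K (T ⊓ W : Submodule K V) ≤ finrank K (U ⊓ W : Submodule K V) :=
    Submodule.finrank_mono (inf_le_inf_right _ inf_le_left)
  have h6 : finrank K (T ⊔ W ⊔ N : Submodule K V) ≤ finrank K (W ⊔ N : Submodule K V) := by
    apply Submodule.finrank_mono
    refine sup_le (sup_le ?_ le_sup_left) le_sup_right
    rw [hsup]
    exact inf_le_right
  have h7 := Submodule.finrank_sup_add_finrank_inf_eq W N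
  rw [hdisj, finrank_bot] at h7
  -- As `W^⊥ = W ⊕ N`, this is the image of `U ∩ W^⊥` under projection to `N` along `W`.
  refine ⟨(T ⊔ W) ⊓ N, inf_le_right, ?_, ?_⟩
  · rintro x ⟨hx, hxN⟩ y ⟨hy, hyN⟩
    obtain ⟨u, hu, w, hw, rfl⟩ := Submodule.mem_sup.1 hx
    obtain ⟨u', hu', w', hw', rfl⟩ := Submodule.mem_sup.1 hy
    have e1 := hU u hu.1 u' hu'.1
    have e2 := hWN w hw _ hyN
    have e3 := hu.2 w' hw'
    have e4 : B w' u = 0 := e3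
    rw [hsymm.eq] at e4
    simp only [map_add, LinearMap.add_apply] at e2 ⊢
    simp [e1, e2, e4]
  · have h8 : finrank K (U ⊓ W : Submodule K V) ≤ finrank K V := Submodule.finrank_le _
    have h9 : finrank K W ≤ finrank K V := Submodule.finrank_le _
    omega

/-- A nondegenerate quadratic form with a totally isotropic subspace of half the dimension is
hyperbolic. -/
theorem isHyperbolicForm_of_isotropic (h2 : (2 : K) ≠ 0) (Q : QuadraticForm K V)
    (hQ : (QuadraticMap.polarBilin Q).Nondegenerate) (U : Submodule K V)
    (hU : ∀ x ∈ U, Q x = 0) (hdim : finrank K V ≤ 2 * finrank K U) :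
    IsHyperbolicForm Q := by
  set B : LinearMap.BilinForm K V := QuadraticMap.polarBilin Q with hBdef
  have hBs : ∀ x y, B x y = B y x := fun x y => QuadraticMap.polar_comm Q x y
  have hadd : ∀ x y, Q (x + y) = Q x + Q y + B x y := fun x y => QuadraticMap.map_add Q x y
  have hBQ : ∀ x, B x x = 2 * Q x := fun x => by
    have h : B x x = 2 • Q x := QuadraticMap.polar_self Q x
    rw [h, two_smul, two_mul]
  have hUU : ∀ x ∈ U, ∀ y ∈ U, B x y = 0 := fun x hx y hy => by
    have := hadd x y
    rw [hU _ (U.add_mem hx hy), hU x hx, hU y hy] at this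
    simpa using this.symm
  have hBinj : Function.Injective B := by
    intro x y hxy
    have : x - y = 0 := hQ.1 _ fun z => by simp [hxy]
    exact sub_eq_zero.1 this
  have hBsurj : Function.Surjective B :=
    (LinearMap.injective_iff_surjective_of_finrank_eq_finrank
      (Subspace.dual_finrank_eq (K := K) (V := V)).symm).1 hBinj
  let n := finrank K U
  let b : Basis (Fin n) K U := finBasis K U
  have hex : ∀ j : Fin n, ∃ w : V, ∀ i, B w (b i) = if i = j then 1 else 0 := by
    intro j
    obtain ⟨f, hf⟩ := LinearMap.exists_extend (b.coord j)
    obtain ⟨w, hw⟩ := hBsurj f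
    refine ⟨w, fun i => ?_⟩
    have : f (b i) = b.coord j (b i) := by rw [← hf]; rfl
    rw [hw, this]
    simp [Finsupp.single_apply]
  choose w' hw' using hex
  -- Half of the Gram matrix is subtracted along `U`: the pairing with `U` is unchanged, and the
  -- dual vectors become mutually orthogonal and isotropic.
  let w : Fin n → V := fun j => w' j - ∑ i, (2⁻¹ * B (w' j) (w' i)) • (b i : V)
  have hbb : ∀ i j, B (b i) (b j) = 0 := fun i j => hUU _ (b i).2 _ (b j).2
  have hwb : ∀ i j, B (w j) (b i) = if i = j then 1 else 0 := by
    intro i j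
    simp [w, hw', hbb]
  have hww : ∀ i j, B (w i) (w j) = 0 := by
    intro i j
    have e : B (w i) (w j) = B (w i) (w' j) - 2⁻¹ * B (w' j) (w' i) := by
      simp only [w, map_sub, map_sum, map_smul]
      rw [Finset.sum_congr rfl (g := fun k => if k = i then 2⁻¹ * B (w' j) (w' i) else 0)]
      · simp
      · intro k _
        have := hwb k i
        simp only [w, map_sub, map_sum, map_smul] at this
        rw [this]
        by_cases hk : k = i
        · simp [hk]
        · simp [hk]
    rw [e]
    simp only [w, map_sub, map_sum, map_smul, LinearMap.sub_apply, LinearMap.sum_apply,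
      LinearMap.smul_apply]
    rw [Finset.sum_congr rfl (g := fun k => if k = j then 2⁻¹ * B (w' i) (w' j) else 0)]
    · rw [Finset.sum_ite_eq' , if_pos (Finset.mem_univ _), hBs (w' j) (w' i)]
      field_simp
      ring
    · intro k _
      rw [hBs (b k : V), hw' j k]
      by_cases hk : k = j
      · simp [hk]
      · simp [hk]
  let f : (Fin n → K × K) →ₗ[K] V :=
    ∑ i, (((LinearMap.fst K K K).comp (LinearMap.proj i)).smulRight (b i : V) +
      ((LinearMap.snd K K K).comp (LinearMap.proj i)).smulRight (w i))
  have hf : ∀ p, f p = (∑ i, (p i).1 • (b i : V)) + ∑ i, (p i).2 • w i := by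
    intro p
    simp [f, Finset.sum_add_distrib]
  have hfinj : Function.Injective f := by
    rw [← LinearMap.ker_eq_bot, LinearMap.ker_eq_bot']
    intro p hp
    rw [hf] at hp
    funext k
    refine Prod.ext ?_ ?_
    · have : B (w k) ((∑ i, (p i).1 • (b i : V)) + ∑ i, (p i).2 • w i) = 0 := by rw [hp, map_zero]
      simpa [hwb, hww] using this
    · have : B (b k) ((∑ i, (p i).1 • (b i : V)) + ∑ i, (p i).2 • w i) = 0 := by rw [hp, map_zero]
      have h' : ∀ i, B (b k) (w i) = if k = i then 1 else 0 := fun i => by rw [hBs, hwb]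
      simpa [h', hbb] using this
  have hfr : finrank K (Fin n → K × K) = 2 * n := by
    simp [Module.finrank_pi_fintype, mul_comm]
  have hfbij : Function.Bijective f := by
    refine ⟨hfinj, ?_⟩
    have hle := LinearMap.finrank_le_finrank_of_injective hfinj
    exact (LinearMap.injective_iff_surjective_of_finrank_eq_finrank
      (le_antisymm hle (by rw [hfr]; exact hdim))).1 hfinj
  have hQf : ∀ p, Q (f p) = ∑ i, (p i).1 * (p i).2 := by
    intro p
    have e : B (f p) (f p) = 2 * ∑ i, (p i).1 * (p i).2 := by
      rw [hf]
      have h' : ∀ k i, B (b k) (w i) = if k = i then 1 else 0 := fun k i => by rw [hBs, hwb]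
      simp only [map_add, map_sum, map_smul, LinearMap.add_apply, LinearMap.sum_apply,
        LinearMap.smul_apply, hbb, hww, hwb, h', smul_eq_mul, mul_ite, mul_one, mul_zero,
        Finset.sum_ite_eq, Finset.sum_ite_eq', Finset.mem_univ, if_true, Finset.sum_const_zero,
        zero_add, add_zero, two_mul]
      simp only [mul_comm]
    rw [hBQ] at e
    exact mul_left_cancel₀ h2 e
  let e := LinearEquiv.ofBijective f hfbij
  refine ⟨n, ⟨QuadraticMap.IsometryEquiv.symm ⟨e, fun p => ?_⟩⟩⟩
  change Q (f p) = _
  rw [hQf]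
  simp [QuadraticMap.pi_apply, hyperbolicPlane]

end LinearAlgebra

/-! ### The subgroup generated by squares, and chains of cyclic steps of order four. -/

section SquareSubgroup

/-- The subgroup generated by the squares. -/
def squareSubgroup (G : Type*) [Group G] : Subgroup G :=
  Subgroup.closure (Set.range fun g : G => g ^ 2)

theorem sq_mem_squareSubgroup {G : Type*} [Group G] (g : G) : g ^ 2 ∈ squareSubgroup G :=
  Subgroup.subset_closure ⟨g, rfl⟩

theorem squareSubgroup_le {G : Type*} [Group G] {S : Subgroup G} (h : ∀ g : G, g ^ 2 ∈ S) :
    squareSubgroup G ≤ S :=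
  (Subgroup.closure_le S).2 (by rintro _ ⟨g, rfl⟩; exact h g)

theorem map_squareSubgroup_le {G H : Type*} [Group G] [Group H] (f : G →* H) :
    (squareSubgroup G).map f ≤ squareSubgroup H := by
  rw [Subgroup.map_le_iff_le_comap]
  exact squareSubgroup_le fun g => by
    rw [Subgroup.mem_comap, map_pow]
    exact sq_mem_squareSubgroup _

theorem map_squareSubgroup_of_surjective {G H : Type*} [Group G] [Group H] (f : G →* H)
    (hf : Function.Surjective f) : (squareSubgroup G).map f = squareSubgroup H := by
  refine le_antisymm (map_squareSubgroup_le f) (squareSubgroup_le fun h => ?_)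
  obtain ⟨g, rfl⟩ := hf h
  exact ⟨g ^ 2, sq_mem_squareSubgroup g, map_pow f g 2⟩

instance {G : Type*} [Group G] : (squareSubgroup G).Characteristic :=
  Subgroup.characteristic_iff_map_eq.2 fun e => map_squareSubgroup_of_surjective _ e.surjective

theorem commutator_mem_squareSubgroup {G : Type*} [Group G] (x y : G) :
    x⁻¹ * y⁻¹ * x * y ∈ squareSubgroup G := by
  have h : x⁻¹ * y⁻¹ * x * y = (x⁻¹ * y⁻¹) ^ 2 * (y * x * y⁻¹) ^ 2 * y ^ 2 := by
    simp only [pow_two]; group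
  rw [h]
  exact mul_mem (mul_mem (sq_mem_squareSubgroup _) (sq_mem_squareSubgroup _))
    (sq_mem_squareSubgroup _)

theorem normal_of_squareSubgroup_le {G : Type*} [Group G] {S : Subgroup G}
    (h : squareSubgroup G ≤ S) : S.Normal := by
  refine ⟨fun n hn g => ?_⟩
  have := h (commutator_mem_squareSubgroup g⁻¹ n⁻¹)
  simp only [inv_inv] at this
  simpa [mul_assoc] using mul_mem this hn

theorem IsPGroup.mem_of_odd_pow_mem {G : Type*} [Group G] (hG : IsPGroup 2 G) {S : Subgroup G}
    {g : G} {k : ℤ} (hk : Odd k) (h : g ^ k ∈ S) : g ∈ S := by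
  have hc : (orderOf g).Coprime k.natAbs :=
    hG.orderOf_coprime (Nat.coprime_two_left.2 (Int.natAbs_odd.2 hk)) g
  have h' : g ^ k.natAbs ∈ S := by
    rcases Int.natAbs_eq k with hk' | hk' <;> rw [hk'] at h
    · exact_mod_cast h
    · rw [zpow_neg, inv_mem_iff] at h
      exact_mod_cast h
  exact (Subgroup.zpowers_le.2 h') (mem_zpowers_pow_iff.2 hc.symm)

/-- Otherwise the normal subgroup `S` and `g ^ 2` generate `G`, so `g = s * g ^ (2 * k)` with `s ∈
S`. An odd power of `g` then lies in `S`, and so does `g`. -/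
theorem IsPGroup.sq_mem_of_isCoatom {G : Type*} [Group G] [Finite G] (hG : IsPGroup 2 G)
    {S : Subgroup G} (hS : IsCoatom S) (g : G) : g ^ 2 ∈ S := by
  have : Fact (Nat.Prime 2) := ⟨Nat.prime_two⟩
  have := hG.isNilpotent
  have hn : S.Normal := Subgroup.NormalizerCondition.normal_of_coatom S
    Group.normalizerCondition_of_isNilpotent hS
  by_contra hg
  have hlt : S < S ⊔ Subgroup.zpowers (g ^ 2) :=
    left_lt_sup.2 fun h => hg (h (Subgroup.mem_zpowers _))
  have htop := hS.2 _ hlt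
  have hmem : g ∈ S ⊔ Subgroup.zpowers (g ^ 2) := htop ▸ Subgroup.mem_top g
  rw [Subgroup.mem_sup_of_normal_left] at hmem
  obtain ⟨s, hs, t, ⟨k, rfl⟩, hst⟩ := hmem
  have hodd : g ^ (1 - 2 * k) = s := by
    rw [zpow_sub, zpow_one, zpow_mul, mul_inv_eq_iff_eq_mul]
    exact_mod_cast hst.symm
  have hgS : g ∈ S :=
    hG.mem_of_odd_pow_mem (k := 1 - 2 * k) (Odd.sub_even odd_one ⟨k, two_mul k⟩) (hodd ▸ hs)
  exact hg (pow_mem hgS 2)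

/-- If `x` is not a product of squares, a subgroup `D` maximal among those that contain all squares
and omit `x` is a coatom: for `g ∉ D`, `x` lies in `D g`, so any larger subgroup contains `x` and
hence `g`. -/
theorem IsPGroup.frattini_eq_squareSubgroup {G : Type*} [Group G] [Finite G] (hG : IsPGroup 2 G) :
    frattini G = squareSubgroup G := by
  apply le_antisymm
  · intro x hx
    by_contra hxs
    obtain ⟨D, hD, hmax⟩ := (Set.toFinite {D : Subgroup G | squareSubgroup G ≤ D ∧ x ∉ D}).exists_le_maximal
      (a := squareSubgroup G) ⟨le_rfl, hxs⟩
    have hDn := normal_of_squareSubgroup_le hmax.1.1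
    have hxD : ∀ E, D < E → x ∈ E := fun E hE => by
      by_contra hxE
      exact hE.not_ge (hmax.2 ⟨hmax.1.1.trans hE.le, hxE⟩ hE.le)
    have hco : IsCoatom D := by
      refine ⟨fun h => hmax.1.2 (h ▸ Subgroup.mem_top x), fun E hE => ?_⟩
      refine (Subgroup.eq_top_iff' E).2 fun g => ?_
      by_cases hg : g ∈ D
      · exact hE.le hg
      have hxg : x ∈ D ⊔ Subgroup.zpowers g :=
        hxD _ (left_lt_sup.2 fun h => hg (h (Subgroup.mem_zpowers _)))
      rw [Subgroup.mem_sup_of_normal_left] at hxg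
      obtain ⟨s, hs, t, ⟨k, rfl⟩, hst⟩ := hxg
      simp only at hst
      have hg2 : ∀ m : ℤ, g ^ (2 * m) ∈ D := fun m => by
        rw [zpow_mul]
        exact zpow_mem (hmax.1.1 (by exact_mod_cast sq_mem_squareSubgroup g)) m
      rcases Int.even_or_odd' k with ⟨m, rfl | rfl⟩
      · exact absurd (hst ▸ mul_mem hs (hg2 m)) hmax.1.2
      · have : g = (s * g ^ (2 * m))⁻¹ * x := by
          rw [← hst, zpow_add]; group
        rw [this]
        exact mul_mem (hE.le (inv_mem (mul_mem hs (hg2 m)))) (hxD E hE)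
    exact hmax.1.2 (frattini_le_coatom hco hx)
  · refine squareSubgroup_le fun g => ?_
    rw [frattini, Order.radical]
    simp only [Subgroup.mem_iInf]
    exact fun S hS => hG.sq_mem_of_isCoatom hS g

/-- `C / B` is the subgroup of order two of the cyclic group of order four generated by `g` modulo
`B`. -/
structure IsFourStep {G : Type*} [Group G] (g : G) (B C : Subgroup G) : Prop where
  conj_mem : ∀ b ∈ B, g⁻¹ * b * g ∈ B
  sq_notMem : g ^ 2 ∉ B
  pow_four_mem : g ^ 4 ∈ B
  mem_iff : ∀ c, c ∈ C ↔ c ∈ B ∨ g ^ 2 * c ∈ B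

theorem IsFourStep.map {G H : Type*} [Group G] [Group H] {f : G →* H}
    (hf : Function.Injective f) {g : G} {B C : Subgroup G} (h : IsFourStep g B C) :
    IsFourStep (f g) (B.map f) (C.map f) where
  conj_mem := by
    rintro _ ⟨b, hb, rfl⟩
    exact ⟨_, h.conj_mem b hb, by simp⟩
  sq_notMem := by
    rw [← map_pow, Subgroup.mem_map_iff_mem hf]
    exact h.sq_notMem
  pow_four_mem := by
    rw [← map_pow, Subgroup.mem_map_iff_mem hf]
    exact h.pow_four_mem
  mem_iff := by
    intro c
    constructor
    · rintro ⟨c, hc, rfl⟩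
      rw [← map_pow, ← map_mul, Subgroup.mem_map_iff_mem hf, Subgroup.mem_map_iff_mem hf]
      exact (h.mem_iff c).1 hc
    · rintro (⟨b, hb, rfl⟩ | ⟨b, hb, hbc⟩)
      · exact ⟨b, (h.mem_iff b).2 (Or.inl hb), rfl⟩
      · refine ⟨(g ^ 2)⁻¹ * b, (h.mem_iff _).2 (Or.inr (by simpa using hb)), ?_⟩
        rw [map_mul, hbc, map_inv, map_pow, inv_mul_cancel_left]

theorem IsFourStep.comap {G H : Type*} [Group G] [Group H] {f : G →* H} {g : G}
    {B C : Subgroup H} (h : IsFourStep (f g) B C) : IsFourStep g (B.comap f) (C.comap f) where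
  conj_mem b hb := by simpa using h.conj_mem _ hb
  sq_notMem := by simpa using h.sq_notMem
  pow_four_mem := by simpa using h.pow_four_mem
  mem_iff c := by simpa using h.mem_iff (f c)

/-- Induction on the order. If a maximal subgroup `A` has a non-trivial square subgroup `N`, the
chain for `A` leads from `⊥` to `N`, and the chain for `G ⧸ N` pulls back to one from `N` to the
squares of `G`. -/
theorem rel_bot_squareSubgroup_of_card_eq (n : ℕ) : ∀ (G : Type*) [Group G] [Finite G],
    Nat.card G = n → IsPGroup 2 G → ∀ R : Subgroup G → Subgroup G → Prop, (∀ B, R B B) →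
    (∀ B C D, R B C → R C D → R B D) → (∀ g B C, IsFourStep g B C → R B C) →
    R ⊥ (squareSubgroup G) := by
  induction n using Nat.strong_induction_on with
  | _ n ih =>
  intro G _ _ hn hG R hrefl htrans hstep
  have : Fact (Nat.Prime 2) := ⟨Nat.prime_two⟩
  have := hG.isNilpotent
  by_cases hA : ∃ A : Subgroup G, IsCoatom A ∧ squareSubgroup A ≠ ⊥
  · obtain ⟨A, hAco, hA⟩ := hA
    have hAn : A.Normal := Subgroup.NormalizerCondition.normal_of_coatom A
      Group.normalizerCondition_of_isNilpotent hAco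
    set N : Subgroup G := (squareSubgroup A).map A.subtype with hN
    have hNn : N.Normal := inferInstance
    have h1 : R ⊥ N := by
      have hcard : Nat.card A < n := by
        rw [← hn]
        exact lt_of_le_of_ne (Subgroup.card_le_card_group A)
          fun h => hAco.1 (Subgroup.eq_top_of_card_eq A h)
      have := ih _ hcard A rfl (hG.to_subgroup A)
        (fun B C => R (B.map A.subtype) (C.map A.subtype)) (fun _ => hrefl _)
        (fun _ _ _ => htrans _ _ _) (fun g B C h => hstep _ _ _ (h.map A.subtype_injective))
      simpa using this
    have h2 : R N (squareSubgroup G) := by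
      have hNbot : N ≠ ⊥ := fun h => hA ((Subgroup.map_eq_bot_iff_of_injective _
        A.subtype_injective).1 h)
      have hcard : Nat.card (G ⧸ N) < n := by
        rw [← hn, Subgroup.card_eq_card_quotient_mul_card_subgroup N]
        exact lt_mul_of_one_lt_right Nat.card_pos (Subgroup.one_lt_card_iff_ne_bot N |>.2 hNbot)
      have := ih _ hcard (G ⧸ N) rfl (hG.to_quotient N)
        (fun B C => R (B.comap (QuotientGroup.mk' N)) (C.comap (QuotientGroup.mk' N)))
        (fun _ => hrefl _) (fun _ _ _ => htrans _ _ _) (fun g B C h => by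
          obtain ⟨g, rfl⟩ := QuotientGroup.mk'_surjective N g
          exact hstep g _ _ h.comap)
      rw [← map_squareSubgroup_of_surjective _ (QuotientGroup.mk'_surjective N),
        QuotientGroup.comap_map_mk', sup_eq_right.2 (map_squareSubgroup_le A.subtype)] at this
      simpa using this
    exact htrans _ _ _ h1 h2
  -- Now all maximal subgroups have exponent at most two. An element `y` with `y ^ 2 ≠ 1` lies in
  -- none of them, so it generates `G`; but `y ^ 2` does, so `G` is cyclic of order four and a
  -- single step suffices.
  · push Not at hA
    by_cases hbot : squareSubgroup G = ⊥
    · rw [hbot]; exact hrefl _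
    obtain ⟨y, hy⟩ : ∃ y : G, y ^ 2 ≠ 1 := by
      by_contra! h
      exact hbot (le_bot_iff.1 (squareSubgroup_le fun g => by simp [h g]))
    have hco : ∀ A : Subgroup G, IsCoatom A → ∀ a ∈ A, a ^ 2 = 1 := fun A hA' a ha => by
      have := sq_mem_squareSubgroup (⟨a, ha⟩ : A)
      rw [hA A hA', Subgroup.mem_bot] at this
      exact congrArg Subtype.val this
    have htop : Subgroup.zpowers y = ⊤ := by
      by_contra h
      obtain ⟨A, hA', hle⟩ := (eq_top_or_exists_le_coatom (Subgroup.zpowers y)).resolve_left h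
      exact hy (hco A hA' y (hle (Subgroup.mem_zpowers y)))
    obtain ⟨A, hA', -⟩ := (eq_top_or_exists_le_coatom (⊥ : Subgroup G)).resolve_left fun h => by
      have := Subgroup.mem_bot.1 (h ▸ Subgroup.mem_top y : y ∈ (⊥ : Subgroup G))
      simp [this] at hy
    have hy4 : y ^ 4 = 1 := by
      have := hco A hA' _ (hG.sq_mem_of_isCoatom hA' y)
      rwa [← pow_mul] at this
    have hzp : ∀ k : ℤ, y ^ (2 * k) = 1 ∨ y ^ 2 * y ^ (2 * k) = 1 := fun k => by
      have h4 : ∀ m : ℤ, y ^ (4 * m) = 1 := fun m => by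
        rw [zpow_mul]
        have : y ^ (4 : ℤ) = 1 := by exact_mod_cast hy4
        rw [this, one_zpow]
      rcases Int.even_or_odd' k with ⟨m, rfl | rfl⟩
      · left; rw [← mul_assoc]; exact h4 m
      · right
        have : y ^ 2 * y ^ (2 * (2 * m + 1)) = y ^ (4 * (m + 1)) := by
          rw [← zpow_natCast y 2, ← zpow_add]
          congr 1
          push_cast; ring
        rw [this, h4]
    refine hstep y _ _ ⟨by simp, by simpa using hy, by simpa using hy4, fun c => ?_⟩
    rw [Subgroup.mem_bot, Subgroup.mem_bot]
    constructor
    · intro hc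
      have hle : squareSubgroup G ≤ Subgroup.zpowers (y ^ 2) := squareSubgroup_le fun g => by
        obtain ⟨k, rfl⟩ := (htop ▸ Subgroup.mem_top g : g ∈ Subgroup.zpowers y)
        refine ⟨k, ?_⟩
        simp only
        rw [← zpow_natCast y 2, ← zpow_mul, ← zpow_natCast, ← zpow_mul, mul_comm]
      obtain ⟨k, rfl⟩ := hle hc
      simp only
      have := hzp k
      rw [zpow_mul] at this
      exact_mod_cast this
    · rintro (rfl | h)
      · exact one_mem _
      · rw [eq_inv_of_mul_eq_one_right h]
        exact inv_mem (sq_mem_squareSubgroup y)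

/-- A reflexive and transitive relation between the subgroups of a finite `2`-group that holds for
the steps in cyclic subquotients of order four holds between the trivial subgroup and the subgroup
generated by the squares. -/
theorem rel_bot_squareSubgroup {G : Type*} [Group G] [Finite G] (hG : IsPGroup 2 G)
    (R : Subgroup G → Subgroup G → Prop) (hrefl : ∀ B, R B B)
    (htrans : ∀ B C D, R B C → R C D → R B D) (hstep : ∀ g B C, IsFourStep g B C → R B C) :
    R ⊥ (squareSubgroup G) :=
  rel_bot_squareSubgroup_of_card_eq _ G rfl hG R hrefl htrans hstep

end SquareSubgroup

/-! ### The trace form on fixed fields, and metabolic complements. -/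

section TraceForm

variable {K M : Type*} [Field K] [Field M] [Algebra K M]

/-- The elements of `M` fixed by `B`, as a subspace over `K`. -/
def fixedSubmodule (B : Subgroup (M ≃ₐ[K] M)) : Submodule K M where
  carrier := {m | ∀ g ∈ B, g m = m}
  add_mem' hx hy g hg := by rw [map_add, hx g hg, hy g hg]
  zero_mem' g _ := map_zero g
  smul_mem' k x hx g hg := by rw [map_smul, hx g hg]

theorem mem_fixedSubmodule {B : Subgroup (M ≃ₐ[K] M)} {m : M} :
    m ∈ fixedSubmodule B ↔ ∀ g ∈ B, g m = m := Iff.rfl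

theorem fixedSubmodule_anti {B C : Subgroup (M ≃ₐ[K] M)} (h : B ≤ C) :
    fixedSubmodule C ≤ fixedSubmodule B := fun _ hm g hg => hm g (h hg)

theorem fixedSubmodule_bot : fixedSubmodule (⊥ : Subgroup (M ≃ₐ[K] M)) = ⊤ := by
  refine (Submodule.eq_top_iff').2 fun m g hg => ?_
  rw [Subgroup.mem_bot.1 hg]; rfl

theorem mul_mem_fixedSubmodule {B : Subgroup (M ≃ₐ[K] M)} {m n : M} (hm : m ∈ fixedSubmodule B)
    (hn : n ∈ fixedSubmodule B) : m * n ∈ fixedSubmodule B :=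
  fun g hg => by rw [map_mul, hm g hg, hn g hg]

theorem inv_mem_fixedSubmodule {B : Subgroup (M ≃ₐ[K] M)} {m : M} (hm : m ∈ fixedSubmodule B) :
    m⁻¹ ∈ fixedSubmodule B :=
  fun g hg => by rw [map_inv₀, hm g hg]

theorem mem_of_forall_fixedSubmodule [FiniteDimensional K M] {B : Subgroup (M ≃ₐ[K] M)}
    {g : M ≃ₐ[K] M} (h : ∀ m ∈ fixedSubmodule B, g m = m) : g ∈ B := by
  rw [← IntermediateField.fixingSubgroup_fixedField B, IntermediateField.mem_fixingSubgroup_iff]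
  exact fun m hm => h m fun g hg => hm ⟨g, hg⟩

theorem trace_apply_algEquiv (g : M ≃ₐ[K] M) (m : M) :
    Algebra.trace K M (g m) = Algebra.trace K M m :=
  Algebra.trace_eq_of_algEquiv g m

theorem trace_eq_zero_of_neg (h2 : (2 : K) ≠ 0) (g : M ≃ₐ[K] M) {m : M} (h : g m = -m) :
    Algebra.trace K M m = 0 := by
  have := trace_apply_algEquiv g m
  rw [h, map_neg] at this
  have h' : (2 : K) * Algebra.trace K M m = 0 := by linear_combination -this
  exact (mul_eq_zero.1 h').resolve_left h2

theorem finrank_map_mulLeft {y : M} (hy : y ≠ 0) (T : Submodule K M) :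
    finrank K (T.map (LinearMap.mulLeft K y)) = finrank K T :=
  (Submodule.equivMapOfInjective _ (fun _ _ h => mul_left_cancel₀ hy h) T).finrank_eq.symm

theorem finrank_eq_two_mul [FiniteDimensional K M] {S T : Submodule K M} {y : M} (hy : y ≠ 0)
    (hT : T ≤ S) (hyT : ∀ t ∈ T, y * t ∈ S) (hdisj : ∀ t ∈ T, y * t ∈ T → t = 0)
    (hdec : ∀ m ∈ S, ∃ t ∈ T, ∃ t' ∈ T, m = t + y * t') : finrank K S = 2 * finrank K T := by
  have hsup : S = T ⊔ T.map (LinearMap.mulLeft K y) := by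
    apply le_antisymm
    · intro m hm
      obtain ⟨t, ht, t', ht', rfl⟩ := hdec m hm
      exact Submodule.add_mem_sup ht ⟨t', ht', rfl⟩
    · refine sup_le hT ?_
      rintro _ ⟨t, ht, rfl⟩
      exact hyT t ht
  have hinf : T ⊓ T.map (LinearMap.mulLeft K y) = ⊥ := by
    rw [eq_bot_iff]
    rintro _ ⟨hm, t, ht, rfl⟩
    have : t = 0 := hdisj t ht hm
    simp [this]
  have := Submodule.finrank_sup_add_finrank_inf_eq T (T.map (LinearMap.mulLeft K y))
  rw [hinf, finrank_bot, ← hsup, finrank_map_mulLeft hy] at this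
  omega

theorem two_ne_zero_of_algebra (h2 : (2 : K) ≠ 0) : (2 : M) ≠ 0 := by
  have := (map_ne_zero (algebraMap K M)).2 h2
  rwa [map_ofNat] at this

/-- The halving `m = (m + εgm)/2 + (m - εgm)/2` with respect to an involution. -/
theorem exists_add_mul_of_involutive (h2 : (2 : K) ≠ 0) (S : Submodule K M) (g : M ≃ₐ[K] M) {y : M}
    (hy : y ≠ 0) (hgy : g y = -y) (hgS : ∀ m ∈ S, g m ∈ S) (hgg : ∀ m ∈ S, g (g m) = m)
    (hyS : ∀ m ∈ S, y⁻¹ * m ∈ S) {m : M} (hm : m ∈ S) :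
    ∃ t, (t ∈ S ∧ g t = t) ∧ ∃ t', (t' ∈ S ∧ g t' = t') ∧ m = t + y * t' := by
  have h2' : (2 : M) ≠ 0 := two_ne_zero_of_algebra h2
  refine ⟨(2 : K)⁻¹ • (m + g m), ⟨S.smul_mem _ (S.add_mem hm (hgS m hm)), ?_⟩,
    (2 : K)⁻¹ • (y⁻¹ * (m - g m)), ⟨S.smul_mem _ (hyS _ (S.sub_mem hm (hgS m hm))), ?_⟩, ?_⟩
  · rw [map_smul, map_add, hgg m hm, add_comm]
  · rw [map_smul, map_mul, map_inv₀, hgy, map_sub, hgg m hm]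
    congr 1
    rw [inv_neg]; ring
  · simp only [Algebra.smul_def, map_inv₀, map_ofNat]
    field_simp
    ring

theorem finrank_eq_two_mul_of_involutive [FiniteDimensional K M] (h2 : (2 : K) ≠ 0)
    {S T : Submodule K M} {g : M ≃ₐ[K] M} {y : M}
    (hT : ∀ m, m ∈ T ↔ m ∈ S ∧ g m = m) (hy : y ≠ 0) (hgy : g y = -y)
    (hgS : ∀ m ∈ S, g m ∈ S) (hgg : ∀ m ∈ S, g (g m) = m) (hyS : ∀ m ∈ S, y * m ∈ S)
    (hyS' : ∀ m ∈ S, y⁻¹ * m ∈ S) : finrank K S = 2 * finrank K T := by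
  refine finrank_eq_two_mul hy (fun t ht => ((hT t).1 ht).1) (fun t ht => hyS t ((hT t).1 ht).1)
    (fun t ht hyt => ?_) (fun m hm => ?_)
  · have h1 := ((hT _).1 hyt).2
    rw [map_mul, hgy, ((hT t).1 ht).2] at h1
    have h3 : (2 : M) * (y * t) = 0 := by linear_combination -h1
    exact (mul_eq_zero.1 ((mul_eq_zero.1 h3).resolve_left (two_ne_zero_of_algebra h2))).resolve_left hy
  · obtain ⟨t, ht, t', ht', h⟩ := exists_add_mul_of_involutive h2 S g hy hgy hgS hgg hyS' hm
    exact ⟨t, (hT t).2 ht, t', (hT t').2 ht', h⟩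

/-- The orthogonal complement of the fixed field of `C` in that of `B`, for the trace form, has a
totally isotropic subspace of half its dimension. -/
def IsMetabolicStep (B C : Subgroup (M ≃ₐ[K] M)) : Prop :=
  B ≤ C ∧ ∃ W ≤ fixedSubmodule B,
    (∀ x ∈ W, ∀ y ∈ W, Algebra.trace K M (x * y) = 0) ∧
    (∀ x ∈ W, ∀ y ∈ fixedSubmodule C, Algebra.trace K M (x * y) = 0) ∧
    2 * finrank K W + finrank K (fixedSubmodule C) = finrank K (fixedSubmodule B)

theorem IsMetabolicStep.refl (B : Subgroup (M ≃ₐ[K] M)) : IsMetabolicStep B B :=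
  ⟨le_rfl, ⊥, bot_le, by simp, by simp, by simp⟩

/-- For arbitrary `n`, the sum of its conjugates under `C` is fixed by `C`, and pairing it with `m`
gives `|C| · Tr(m n)`. Since `|C|` is a power of two, it is invertible, and nondegeneracy on `M`
applies. -/
theorem eq_zero_of_forall_trace_mul_eq_zero [FiniteDimensional K M] [IsGalois K M]
    (h2 : (2 : K) ≠ 0) (hp : IsPGroup 2 (M ≃ₐ[K] M)) {C : Subgroup (M ≃ₐ[K] M)} {m : M}
    (hm : m ∈ fixedSubmodule C) (h : ∀ n ∈ fixedSubmodule C, Algebra.trace K M (m * n) = 0) :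
    m = 0 := by
  classical
  have : Fintype C := Fintype.ofFinite C
  refine (traceForm_nondegenerate K M).1 m fun n => ?_
  have hn : (∑ c : C, (c : M ≃ₐ[K] M) n) ∈ fixedSubmodule C := fun g hg => by
    rw [map_sum]
    exact Fintype.sum_equiv (Equiv.mulLeft (⟨g, hg⟩ : C)) _ _ fun c => rfl
  have h0 := h _ hn
  rw [Finset.mul_sum, map_sum, Finset.sum_congr rfl (g := fun _ => Algebra.trace K M (m * n)),
    Finset.sum_const, Finset.card_univ, nsmul_eq_mul] at h0
  · obtain ⟨k, hk⟩ := (IsPGroup.iff_card (p := 2)).1 (hp.to_subgroup C)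
    rw [Nat.card_eq_fintype_card] at hk
    rw [hk] at h0
    refine (mul_eq_zero.1 h0).resolve_left ?_
    push_cast
    exact pow_ne_zero _ h2
  · intro c _
    rw [← trace_apply_algEquiv (c : M ≃ₐ[K] M) (m * n), map_mul (c : M ≃ₐ[K] M), hm c c.2]

theorem IsMetabolicStep.trans [FiniteDimensional K M] [IsGalois K M]
    (h2 : (2 : K) ≠ 0) (hp : IsPGroup 2 (M ≃ₐ[K] M)) {B C D : Subgroup (M ≃ₐ[K] M)}
    (hBC : IsMetabolicStep B C) (hCD : IsMetabolicStep C D) : IsMetabolicStep B D := by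
  obtain ⟨hBC, W, hWB, hW, hWC, hWdim⟩ := hBC
  obtain ⟨hCD, W', hWC', hW', hWD', hWdim'⟩ := hCD
  refine ⟨hBC.trans hCD, W ⊔ W', sup_le hWB (hWC'.trans (fixedSubmodule_anti hBC)), ?_, ?_, ?_⟩
  · intro x hx y hy
    obtain ⟨u, hu, w, hw, rfl⟩ := Submodule.mem_sup.1 hx
    obtain ⟨u', hu', w', hw', rfl⟩ := Submodule.mem_sup.1 hy
    have h1 := hWC u' hu' w (hWC' hw)
    rw [mul_comm] at h1
    simp [add_mul, mul_add, hW u hu u' hu', hW' w hw w' hw', hWC u hu w' (hWC' hw'), h1]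
  · intro x hx y hy
    obtain ⟨u, hu, w, hw, rfl⟩ := Submodule.mem_sup.1 hx
    simp [add_mul, hWD' w hw y hy, hWC u hu y (fixedSubmodule_anti hCD hy)]
  · have hinf : W ⊓ W' = ⊥ := by
      rw [eq_bot_iff]
      rintro m ⟨hm, hm'⟩
      exact eq_zero_of_forall_trace_mul_eq_zero h2 hp (hWC' hm') (hWC m hm)
    have := Submodule.finrank_sup_add_finrank_inf_eq W W'
    rw [hinf, finrank_bot] at this
    omega

/-- Kummer generator: on `n = m - g² m ≠ 0` the square of `g` is `-1`, so `n - j • g n` is an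
eigenvector for `j` unless it vanishes. In that case `g n = -j • n`, and `n⁻¹` has eigenvalue
`(-j)⁻¹ = j`. -/
theorem exists_apply_eq_mul_of_isFourStep [FiniteDimensional K M]
    {j : K} (hj : j ^ 2 = -1) {g : M ≃ₐ[K] M} {B C : Subgroup (M ≃ₐ[K] M)}
    (h : IsFourStep g B C) (hgB : ∀ m ∈ fixedSubmodule B, g m ∈ fixedSubmodule B) :
    ∃ y ∈ fixedSubmodule B, y ≠ 0 ∧ g y = j • y := by
  obtain ⟨m, hm, hgm⟩ : ∃ m ∈ fixedSubmodule B, (g ^ 2) m ≠ m := by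
    by_contra! hc
    exact h.sq_notMem (mem_of_forall_fixedSubmodule hc)
  have hg4 : g (g (g (g m))) = m := hm _ h.pow_four_mem
  set n := m - g (g m) with hn
  have hnB : n ∈ fixedSubmodule B := Submodule.sub_mem _ hm (hgB _ (hgB _ hm))
  have hn0 : n ≠ 0 := fun h0 => hgm (sub_eq_zero.1 h0).symm
  have hggn : g (g n) = -n := by
    rw [hn, map_sub, map_sub, hg4, neg_sub]
  have hjj : ∀ x : M, j • j • x = -x := fun x => by
    rw [smul_smul, ← pow_two, hj, neg_one_smul]
  by_cases hy : n - j • g n = 0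
  · have hgn : g n = -(j • n) := by
      have := congrArg (fun x => j • x) hy
      simp only [smul_sub, hjj, smul_zero] at this
      linear_combination this
    refine ⟨n⁻¹, inv_mem_fixedSubmodule hnB, inv_ne_zero hn0, ?_⟩
    rw [map_inv₀, hgn]
    have hj0 : algebraMap K M j ≠ 0 := by
      rw [Ne, map_eq_zero]
      rintro rfl
      norm_num at hj
    have hj' : algebraMap K M j ^ 2 = -1 := by rw [← map_pow, hj, map_neg, map_one]
    rw [Algebra.smul_def, Algebra.smul_def]
    field_simp
    linear_combination -hj'
  · refine ⟨_, Submodule.sub_mem _ hnB (Submodule.smul_mem _ j (hgB _ hnB)), hy, ?_⟩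
    rw [map_sub, map_smul, hggn, smul_sub, hjj, smul_neg]
    ring

theorem IsFourStep.isMetabolicStep [FiniteDimensional K M] (h2 : (2 : K) ≠ 0)
    {j : K} (hj : j ^ 2 = -1) {g : M ≃ₐ[K] M} {B C : Subgroup (M ≃ₐ[K] M)}
    (h : IsFourStep g B C) : IsMetabolicStep B C := by
  have hgB : ∀ m ∈ fixedSubmodule B, g m ∈ fixedSubmodule B := fun m hm b hb => by
    have := hm _ (h.conj_mem b hb)
    have h' := congrArg g this
    simpa [AlgEquiv.mul_apply] using h'
  obtain ⟨y, hyB, hy0, hgy⟩ := exists_apply_eq_mul_of_isFourStep hj h hgB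
  have hjj : ∀ x : M, j • j • x = -x := fun x => by
    rw [smul_smul, ← pow_two, hj, neg_one_smul]
  have hBC : B ≤ C := fun b hb => (h.mem_iff b).2 (Or.inl hb)
  have hg2C : g ^ 2 ∈ C := (h.mem_iff _).2 (Or.inr (by rw [← pow_add]; exact h.pow_four_mem))
  have hC : ∀ m, m ∈ fixedSubmodule C ↔ m ∈ fixedSubmodule B ∧ (g ^ 2) m = m := by
    refine fun m => ⟨fun hm => ⟨fixedSubmodule_anti hBC hm, hm _ hg2C⟩, fun hm c hc => ?_⟩
    rcases (h.mem_iff c).1 hc with hc | hc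
    · exact hm.1 c hc
    · have h1 := hm.1 _ hc
      rw [AlgEquiv.mul_apply] at h1
      exact (g ^ 2).injective (h1.trans hm.2.symm)
  let E : Submodule K M :=
    { carrier := {m | m ∈ fixedSubmodule B ∧ g m = m}
      add_mem' := fun hx hy => ⟨Submodule.add_mem _ hx.1 hy.1, by rw [map_add, hx.2, hy.2]⟩
      zero_mem' := ⟨Submodule.zero_mem _, map_zero g⟩
      smul_mem' := fun k x hx => ⟨Submodule.smul_mem _ k hx.1, by rw [map_smul, hx.2]⟩ }
  have hggy : (g ^ 2) y = -y := by
    rw [pow_two, AlgEquiv.mul_apply, hgy, map_smul, hgy, hjj]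
  have hgy2 : g (y ^ 2) = -y ^ 2 := by
    rw [map_pow, hgy, smul_pow, hj, neg_one_smul]
  have hy2B : y ^ 2 ∈ fixedSubmodule B := by
    rw [pow_two]; exact mul_mem_fixedSubmodule hyB hyB
  have hgg : ∀ m ∈ fixedSubmodule C, g (g m) = m := fun m hm => ((hC m).1 hm).2
  have hy2C : y ^ 2 ∈ fixedSubmodule C := (hC _).2 ⟨hy2B, by rw [map_pow, hggy, neg_sq]⟩
  have dB : finrank K (fixedSubmodule B) = 2 * finrank K (fixedSubmodule C) := by
    refine finrank_eq_two_mul_of_involutive h2 hC hy0 hggy (fun m hm => hgB _ (hgB m hm))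
      (fun m hm => ?_) (fun m hm => mul_mem_fixedSubmodule hyB hm)
      (fun m hm => mul_mem_fixedSubmodule (inv_mem_fixedSubmodule hyB) hm)
    exact hm _ h.pow_four_mem
  have dC : finrank K (fixedSubmodule C) = 2 * finrank K E := by
    refine finrank_eq_two_mul_of_involutive (g := g) h2 (fun m => ?_) (pow_ne_zero 2 hy0) hgy2
      (fun m hm => ?_) hgg
      (fun m hm => mul_mem_fixedSubmodule hy2C hm)
      (fun m hm => mul_mem_fixedSubmodule (inv_mem_fixedSubmodule hy2C) hm)
    · refine ⟨fun hm => ⟨(hC m).2 ⟨hm.1, ?_⟩, hm.2⟩, fun hm => ⟨((hC m).1 hm.1).1, hm.2⟩⟩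
      rw [pow_two, AlgEquiv.mul_apply, hm.2, hm.2]
    · exact (hC _).2 ⟨hgB m ((hC m).1 hm).1, congrArg g (hgg m hm)⟩
  have hW : ∀ x ∈ E.map (LinearMap.mulLeft K y), x ∈ fixedSubmodule B ∧ g x = j • x := by
    rintro _ ⟨t, ht, rfl⟩
    refine ⟨mul_mem_fixedSubmodule hyB ht.1, ?_⟩
    rw [LinearMap.mulLeft_apply, map_mul, ht.2, hgy, smul_mul_assoc]
  -- `W = y E` is the `j`-eigenspace of `g`. Products of two of its elements are negated by `g`,
  -- products with elements of `M^C` by `g²`; in both cases the trace vanishes.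
  refine ⟨hBC, E.map (LinearMap.mulLeft K y), fun x hx => (hW x hx).1, ?_, ?_, ?_⟩
  · intro u hu v hv
    refine trace_eq_zero_of_neg h2 g ?_
    rw [map_mul, (hW u hu).2, (hW v hv).2, smul_mul_smul_comm, ← pow_two, hj, neg_one_smul]
  · intro u hu v hv
    refine trace_eq_zero_of_neg h2 (g ^ 2) ?_
    rw [map_mul, hv _ hg2C, pow_two, AlgEquiv.mul_apply, (hW u hu).2, map_smul, (hW u hu).2, hjj,
      neg_mul]
  · rw [finrank_map_mulLeft hy0]
    omega

theorem isMetabolicStep_map_squareSubgroup [FiniteDimensional K M] [IsGalois K M]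
    (h2 : (2 : K) ≠ 0) {j : K} (hj : j ^ 2 = -1) (hp : IsPGroup 2 (M ≃ₐ[K] M))
    (H : Subgroup (M ≃ₐ[K] M)) : IsMetabolicStep ⊥ ((squareSubgroup H).map H.subtype) := by
  have := rel_bot_squareSubgroup (hp.to_subgroup H)
    (fun B C => IsMetabolicStep (B.map H.subtype) (C.map H.subtype))
    (fun _ => IsMetabolicStep.refl _) (fun _ _ _ => IsMetabolicStep.trans h2 hp)
    (fun g B C h => (h.map H.subtype_injective).isMetabolicStep h2 hj)
  simpa using this

end TraceForm

/-! ### Lagrange resolvents. -/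

section Eigenvector

variable {K M : Type*} [Field K] [Field M] [Algebra K M]

/-- The resolvent `∑ χ(a)⁻¹ a(u)` is an eigenvector, and Dedekind's independence of characters
provides a `u` for which it is non-zero. -/
theorem exists_eigenvector {A : Type*} [Group A] [Finite A] (f : A →* (M ≃ₐ[K] M))
    (hf : Function.Injective f) (χ : A →* Kˣ) :
    ∃ m : M, m ≠ 0 ∧ ∀ a, f a m = (χ a : K) • m := by
  classical
  have : Fintype A := Fintype.ofFinite A
  let F : A → (M →* M) := fun a => ((f a : M ≃ₐ[K] M) : M →* M)
  have hF : Function.Injective F := fun a b hab => hf (AlgEquiv.ext fun m => DFunLike.congr_fun hab m)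
  have hli := (linearIndependent_monoidHom M M).comp F hF
  rw [Fintype.linearIndependent_iff] at hli
  obtain ⟨u, hu⟩ : ∃ u : M, ∑ a, algebraMap K M ((χ a)⁻¹ : Kˣ) * f a u ≠ 0 := by
    by_contra! h
    have := hli (fun a => algebraMap K M ((χ a)⁻¹ : Kˣ)) (by
      funext u
      simpa [F, Finset.sum_apply] using h u) 1
    simp at this
  refine ⟨_, hu, fun b => ?_⟩
  rw [map_sum, Finset.smul_sum]
  refine Fintype.sum_equiv (Equiv.mulLeft b) _ _ fun a => ?_
  rw [map_mul, AlgEquiv.commutes, Equiv.coe_mulLeft, map_mul f, AlgEquiv.mul_apply, map_mul χ,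
    Algebra.smul_def, ← mul_assoc, ← map_mul]
  congr 2
  rw [mul_inv_rev, Units.val_mul, mul_left_comm, Units.mul_inv, mul_one]

end Eigenvector

/-! ### An explicit Lagrangian in a biquadratic extension. -/

section Biquadratic

variable {K M : Type*} [Field K] [Field M] [Algebra K M] [FiniteDimensional K M]

theorem exists_lagrangian_fixedSubmodule (h2 : (2 : K) ≠ 0) {j : K} (hj : j ^ 2 = -1)
    {N : Subgroup (M ≃ₐ[K] M)} {x y : M ≃ₐ[K] M} (hx : ∀ g ∈ N, g * x = x * g)
    (hy : ∀ g ∈ N, g * y = y * g) (hxx : x ^ 2 ∈ N) (hyy : y ^ 2 ∈ N)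
    (hxy : x⁻¹ * y⁻¹ * x * y ∈ N) {c : M} (hcN : c ∈ fixedSubmodule N) (hxc : x c = -c)
    (hyc : c * y c = 1) :
    ∃ U ≤ fixedSubmodule N, (∀ u ∈ U, ∀ v ∈ U, Algebra.trace K M (u * v) = 0) ∧
      finrank K (fixedSubmodule N) ≤ 2 * finrank K U := by
  have h2M : (2 : M) ≠ 0 := two_ne_zero_of_algebra h2
  have h4M : (4 : M) ≠ 0 := by
    have : (4 : M) = 2 * 2 := by norm_num
    rw [this]; exact mul_ne_zero h2M h2M
  set i : M := algebraMap K M j with hi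
  have hii : i ^ 2 = -1 := by rw [hi, ← map_pow, hj, map_neg, map_one]
  have hxi : x i = i := x.commutes j
  have hyi : y i = i := y.commutes j
  have hx2 : x 2 = 2 := map_ofNat x 2
  have hy2 : y 2 = 2 := map_ofNat y 2
  have hxN : ∀ m ∈ fixedSubmodule N, x m ∈ fixedSubmodule N := fun m hm g hg => by
    rw [← AlgEquiv.mul_apply, hx g hg, AlgEquiv.mul_apply, hm g hg]
  have hyN : ∀ m ∈ fixedSubmodule N, y m ∈ fixedSubmodule N := fun m hm g hg => by
    rw [← AlgEquiv.mul_apply, hy g hg, AlgEquiv.mul_apply, hm g hg]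
  have hxxN : ∀ m ∈ fixedSubmodule N, x (x m) = m := fun m hm => hm _ hxx
  have hyyN : ∀ m ∈ fixedSubmodule N, y (y m) = m := fun m hm => hm _ hyy
  have hxyN : ∀ m ∈ fixedSubmodule N, x (y m) = y (x m) := fun m hm => by
    have h1 := congrArg (fun m => y (x m)) (hm _ hxy)
    simp only [← AlgEquiv.mul_apply] at h1
    rw [← AlgEquiv.mul_apply, ← AlgEquiv.mul_apply, ← h1]
    congr 1
    group
  have hc0 : c ≠ 0 := left_ne_zero_of_mul_eq_one hyc
  have hyc' : y c = c⁻¹ := eq_inv_of_mul_eq_one_right hyc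
  have hcc : c * c⁻¹ = 1 := mul_inv_cancel₀ hc0
  -- Used below to exclude `c = ±i` and `c = ±1`, that is, `s = 0` and `t = 0`.
  have hsc : ∀ k : M, x k = k → c ≠ k := fun k hk hck => by
    have h1 := hxc
    rw [hck, hk] at h1
    have : 2 * c = 0 := by rw [hck]; linear_combination h1
    exact hc0 ((mul_eq_zero.1 this).resolve_left h2M)
  set s := c + c⁻¹ with hs
  set t := c - c⁻¹ with ht
  have hst : s ^ 2 - t ^ 2 = 4 := by rw [hs, ht]; linear_combination 4 * hcc
  have hcinvN : c⁻¹ ∈ fixedSubmodule N := inv_mem_fixedSubmodule hcN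
  have hsN : s ∈ fixedSubmodule N := Submodule.add_mem _ hcN hcinvN
  have htN : t ∈ fixedSubmodule N := Submodule.sub_mem _ hcN hcinvN
  have hxs : x s = -s := by rw [hs, map_add, map_inv₀, hxc, inv_neg]; ring
  have hxt : x t = -t := by rw [ht, map_sub, map_inv₀, hxc, inv_neg]; ring
  have hys : y s = s := by rw [hs, map_add, map_inv₀, hyc', inv_inv]; ring
  have hyt : y t = -t := by rw [ht, map_sub, map_inv₀, hyc', inv_inv]; ring
  have hs0 : s ≠ 0 := fun h => by
    have : (c - i) * (c + i) = 0 := by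
      rw [hs] at h; linear_combination c * h - hcc - hii
    rcases mul_eq_zero.1 this with h | h
    · exact hsc i hxi (by linear_combination h)
    · exact hsc (-i) (by rw [map_neg, hxi]) (by linear_combination h)
  have ht0 : t ≠ 0 := fun h => by
    have : (c - 1) * (c + 1) = 0 := by
      rw [ht] at h; linear_combination c * h + hcc
    rcases mul_eq_zero.1 this with h | h
    · exact hsc 1 (map_one x) (by linear_combination h)
    · exact hsc (-1) (by rw [map_neg, map_one]) (by linear_combination h)
  let S : Submodule K M :=
    { carrier := {m | m ∈ fixedSubmodule N ∧ x m = m}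
      add_mem' := fun hx hy => ⟨Submodule.add_mem _ hx.1 hy.1, by rw [map_add, hx.2, hy.2]⟩
      zero_mem' := ⟨Submodule.zero_mem _, map_zero x⟩
      smul_mem' := fun k _ hm => ⟨Submodule.smul_mem _ k hm.1, by rw [map_smul, hm.2]⟩ }
  let F : Submodule K M :=
    { carrier := {m | m ∈ S ∧ y m = m}
      add_mem' := fun hx hy => ⟨Submodule.add_mem _ hx.1 hy.1, by rw [map_add, hx.2, hy.2]⟩
      zero_mem' := ⟨Submodule.zero_mem _, map_zero y⟩
      smul_mem' := fun k _ hm => ⟨Submodule.smul_mem _ k hm.1, by rw [map_smul, hm.2]⟩ }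
  have hFx : ∀ f ∈ F, x f = f := fun f hf => hf.1.2
  have hFy : ∀ f ∈ F, y f = f := fun f hf => hf.2
  have hFmul : ∀ f ∈ F, ∀ g ∈ F, f * g ∈ F := fun f hf g hg =>
    ⟨⟨mul_mem_fixedSubmodule hf.1.1 hg.1.1, by rw [map_mul, hFx f hf, hFx g hg]⟩,
      by rw [map_mul, hFy f hf, hFy g hg]⟩
  have dN : finrank K (fixedSubmodule N) = 2 * finrank K S :=
    finrank_eq_two_mul_of_involutive h2 (fun m => Iff.rfl) hs0 hxs hxN hxxN
      (fun m hm => mul_mem_fixedSubmodule hsN hm)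
      (fun m hm => mul_mem_fixedSubmodule (inv_mem_fixedSubmodule hsN) hm)
  have hstS : s * t ∈ S := ⟨mul_mem_fixedSubmodule hsN htN, by rw [map_mul, hxs, hxt]; ring⟩
  have hyst : y (s * t) = -(s * t) := by rw [map_mul, hys, hyt]; ring
  have dS : finrank K S = 2 * finrank K F :=
    finrank_eq_two_mul_of_involutive (g := y) h2 (fun m => Iff.rfl) (mul_ne_zero hs0 ht0) hyst
      (fun m hm => ⟨hyN m hm.1, by rw [hxyN m hm.1, hm.2]⟩) (fun m hm => hyyN m hm.1)
      (fun m hm => ⟨mul_mem_fixedSubmodule hstS.1 hm.1, by rw [map_mul, hstS.2, hm.2]⟩)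
      (fun m hm => ⟨mul_mem_fixedSubmodule (inv_mem_fixedSubmodule hstS.1) hm.1, by
        rw [map_mul, map_inv₀, hstS.2, hm.2]⟩)
  -- Over the common fixed field `F` of `x` and `y`, the elements `1, s, t, s t` are eigenvectors
  -- with distinct sign patterns, so only the component along `1` contributes to a trace. In `u²`
  -- and `v²` that component is a multiple of `4 + t² - s² = 0`; in `u v` it is absent. Hence `u F +
  -- v F` is totally isotropic, of half the dimension.
  set u := 2 + t + i * s with hu
  set v := s * t * (2 + t - i * s) with hv
  have hxu : x u = 2 - t - i * s := by
    rw [hu, map_add, map_add, map_mul, hx2, hxt, hxi, hxs]; ring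
  have hxv : x v = s * t * (2 - t + i * s) := by
    rw [hv, map_mul, hstS.2, map_sub, map_add, map_mul, hx2, hxt, hxi, hxs]; ring
  have hu0 : u ≠ 0 := fun h => by
    have h' := hxu
    rw [h, map_zero] at h'
    exact h4M (by linear_combination h - h' - hu)
  have hv0 : v ≠ 0 := fun h => by
    have h' := hxv
    rw [h, map_zero] at h'
    have : (s * t) * 4 = 0 := by linear_combination h - h' - hv
    exact h4M ((mul_eq_zero.1 this).resolve_left (mul_ne_zero hs0 ht0))
  have hNi : ∀ m ∈ fixedSubmodule N, i * m ∈ fixedSubmodule N := fun m hm => by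
    rw [hi, ← Algebra.smul_def]; exact Submodule.smul_mem _ _ hm
  have h2N : (2 : M) ∈ fixedSubmodule N := fun g _ => map_ofNat g 2
  have huN : u ∈ fixedSubmodule N :=
    Submodule.add_mem _ (Submodule.add_mem _ h2N htN) (hNi s hsN)
  have hvN : v ∈ fixedSubmodule N := mul_mem_fixedSubmodule hstS.1
    (Submodule.sub_mem _ (Submodule.add_mem _ h2N htN) (hNi s hsN))
  have huu : ∀ h ∈ F, Algebra.trace K M (h * (u * u)) = 0 := fun h hh => by
    have e : h * (u * u) = h * (4 * t + 4 * i * s) + h * (2 * i * (s * t)) := by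
      rw [hu]; linear_combination h * s ^ 2 * hii - h * hst
    rw [e, map_add, trace_eq_zero_of_neg h2 x, trace_eq_zero_of_neg h2 y, add_zero]
    · rw [map_mul, map_mul, map_mul, hyst, hFy h hh, hyi, hy2]; ring
    · simp only [map_mul, map_add, hFx h hh, hxt, hxi, hxs, map_ofNat]; ring
  have hvv : ∀ h ∈ F, Algebra.trace K M (h * (v * v)) = 0 := fun h hh => by
    have e : h * (v * v) = h * (s * t) ^ 2 * (4 * t - 4 * i * s) +
        h * (s * t) ^ 2 * (- 2 * i * (s * t)) := by
      rw [hv]; linear_combination h * (s * t) ^ 2 * s ^ 2 * hii - h * (s * t) ^ 2 * hst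
    rw [e, map_add, trace_eq_zero_of_neg h2 x, trace_eq_zero_of_neg h2 y, add_zero]
    · simp only [map_mul, map_pow, map_neg, hys, hyt, hFy h hh, hyi, map_ofNat]; ring
    · simp only [map_mul, map_sub, map_pow, hFx h hh, hxt, hxi, hxs, map_ofNat]; ring
  have huv : ∀ h ∈ F, Algebra.trace K M (h * (u * v)) = 0 := fun h hh => by
    have e : h * (u * v) = h * (s * t) * (4 + t ^ 2 + s ^ 2) + h * (4 * s * t ^ 2) := by
      rw [hu, hv]; linear_combination - h * (s * t) * s ^ 2 * hii
    rw [e, map_add, trace_eq_zero_of_neg h2 y, trace_eq_zero_of_neg h2 x, add_zero]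
    · simp only [map_mul, map_pow, hFx h hh, hxt, hxs, map_ofNat]; ring
    · simp only [map_mul, map_add, map_pow, hys, hyt, hFy h hh, map_ofNat]; ring
  refine ⟨F.map (LinearMap.mulLeft K u) ⊔ F.map (LinearMap.mulLeft K v), ?_, ?_, ?_⟩
  · refine sup_le ?_ ?_
    · rintro _ ⟨f, hf, rfl⟩; exact mul_mem_fixedSubmodule huN hf.1.1
    · rintro _ ⟨f, hf, rfl⟩; exact mul_mem_fixedSubmodule hvN hf.1.1
  · intro a ha b hb
    obtain ⟨_, ⟨f, hf, rfl⟩, _, ⟨g, hg, rfl⟩, rfl⟩ := Submodule.mem_sup.1 ha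
    obtain ⟨_, ⟨f', hf', rfl⟩, _, ⟨g', hg', rfl⟩, rfl⟩ := Submodule.mem_sup.1 hb
    simp only [LinearMap.mulLeft_apply]
    have e : (u * f + v * g) * (u * f' + v * g') = (f * f') * (u * u) + (f * g') * (u * v) +
      (g * f') * (u * v) + (g * g') * (v * v) := by ring
    rw [e, map_add, map_add, map_add, huu _ (hFmul f hf f' hf'), huv _ (hFmul f hf g' hg'),
      huv _ (hFmul g hg f' hf'), hvv _ (hFmul g hg g' hg')]
    simp
  · have hinf : F.map (LinearMap.mulLeft K u) ⊓ F.map (LinearMap.mulLeft K v) = ⊥ := by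
      rw [eq_bot_iff]
      rintro _ ⟨⟨f, hf, rfl⟩, g, hg, hgf⟩
      simp only [LinearMap.mulLeft_apply] at hgf ⊢
      have h1 := congrArg x hgf
      rw [map_mul x v g, map_mul x u f, hFx f hf, hFx g hg, hxu, hxv] at h1
      have h3 : (s * t) * g = f := by
        refine mul_left_cancel₀ h4M ?_
        rw [hu, hv] at hgf
        linear_combination hgf + h1
      have h4 := congrArg y h3
      rw [map_mul, hyst, hFy f hf, hFy g hg] at h4
      have h5 : f = 0 := by
        refine (mul_eq_zero.1 (?_ : 2 * f = 0)).resolve_left h2M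
        linear_combination -h3 - h4
      simp [h5]
    have := Submodule.finrank_sup_add_finrank_inf_eq (F.map (LinearMap.mulLeft K u))
      (F.map (LinearMap.mulLeft K v))
    rw [hinf, finrank_bot, finrank_map_mulLeft hu0, finrank_map_mulLeft hv0] at this
    omega

end Biquadratic

/-! ### A Lagrangian of `M` from a minimal non-abelian subgroup. -/

section MinimalNonabelian

variable {P : Type*} [Group P] [Finite P]

theorem exists_isCoatom_of_not_commute (hP : IsPGroup 2 P)
    (hab : ∀ S : Subgroup P, S ≠ ⊤ → ∀ a ∈ S, ∀ b ∈ S, a * b = b * a) {x y : P}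
    (hxy : x * y ≠ y * x) :
    ∃ A : Subgroup P, x ∈ A ∧ y ∉ A ∧ squareSubgroup P ≤ A ∧ ∀ a ∈ A, ∀ b ∈ A, a * b = b * a := by
  have hne : Subgroup.zpowers x ≠ ⊤ := fun h => by
    obtain ⟨k, hk⟩ := (h ▸ Subgroup.mem_top y : y ∈ Subgroup.zpowers x)
    simp only at hk
    exact hxy (by rw [← hk]; exact (Commute.self_zpow x k))
  obtain ⟨A, hA, hle⟩ := (eq_top_or_exists_le_coatom (Subgroup.zpowers x)).resolve_left hne
  have hxA := hle (Subgroup.mem_zpowers x)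
  exact ⟨A, hxA, fun hyA => hxy (hab A hA.1 x hxA y hyA),
    squareSubgroup_le (hP.sq_mem_of_isCoatom hA), hab A hA.1⟩

/-- A maximal subgroup containing `x` is abelian and contains all squares. -/
theorem mul_comm_of_mem_squareSubgroup (hP : IsPGroup 2 P)
    (hab : ∀ S : Subgroup P, S ≠ ⊤ → ∀ a ∈ S, ∀ b ∈ S, a * b = b * a) {x y : P}
    (hxy : x * y ≠ y * x) {g : P} (hg : g ∈ squareSubgroup P) : g * x = x * g := by
  obtain ⟨A, hxA, -, hle, hA⟩ := exists_isCoatom_of_not_commute hP hab hxy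
  exact hA g (hle hg) x hxA

theorem exists_character_apply_eq_neg_one {K A : Type*} [Field K] [Group A] [Finite A]
    (hA : ∀ a b : A, a * b = b * a) {e : ℕ} (he0 : e ≠ 0) (he : ∀ a : A, a ^ e = 1) {ζ : K}
    (hζ : IsPrimitiveRoot ζ e) {z : A} (hz : z ≠ 1) (hzz : z ^ 2 = 1) :
    ∃ χ : A →* Kˣ, χ z = -1 := by
  let _ : CommGroup A := { (inferInstance : Group A) with mul_comm := hA }
  have : NeZero e := ⟨he0⟩
  have : HasEnoughRootsOfUnity K e := ⟨⟨ζ, hζ⟩, inferInstance⟩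
  have : HasEnoughRootsOfUnity K (Monoid.exponent A) :=
    HasEnoughRootsOfUnity.of_dvd K (Monoid.exponent_dvd_of_forall_pow_eq_one he)
  obtain ⟨χ, hχ⟩ := CommGroup.exists_apply_ne_one_of_hasEnoughRootsOfUnity A K hz
  refine ⟨χ, ?_⟩
  have h : ((χ z : Kˣ) : K) ^ 2 = 1 := by
    rw [← Units.val_pow_eq_pow_val, ← map_pow, hzz, map_one, Units.val_one]
  rw [pow_two] at h
  rcases mul_self_eq_one_iff.1 h with h | h
  · exact absurd (Units.ext h) hχ
  · exact Units.ext h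

variable {K M : Type*} [Field K] [Field M] [Algebra K M] [FiniteDimensional K M] [IsGalois K M]

theorem exists_lagrangian_of_minimal_nonabelian (h2 : (2 : K) ≠ 0) {j : K} (hj : j ^ 2 = -1)
    (hp : IsPGroup 2 (M ≃ₐ[K] M)) {H : Subgroup (M ≃ₐ[K] M)}
    (hab : ∀ S : Subgroup H, S ≠ ⊤ → ∀ a ∈ S, ∀ b ∈ S, a * b = b * a) {x y : H}
    (hxy : x * y ≠ y * x) {n : ℕ} (hn : n ≠ 0) (he : ∀ h : H, h ^ (2 * n) = 1) {ζ : K}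
    (hζ : IsPrimitiveRoot ζ (2 * n)) :
    ∃ U : Submodule K M, (∀ u ∈ U, ∀ v ∈ U, Algebra.trace K M (u * v) = 0) ∧
      finrank K M ≤ 2 * finrank K U := by
  have hP := hp.to_subgroup H
  obtain ⟨A, hxA, -, hsqA, hA⟩ := exists_isCoatom_of_not_commute hP hab hxy
  have hcx : ∀ g ∈ squareSubgroup H, g * x = x * g := fun g =>
    mul_comm_of_mem_squareSubgroup hP hab hxy
  have hcy : ∀ g ∈ squareSubgroup H, g * y = y * g := fun g =>
    mul_comm_of_mem_squareSubgroup hP hab hxy.symm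
  set z := x⁻¹ * y⁻¹ * x * y with hz
  have hzsq : z ∈ squareSubgroup H := commutator_mem_squareSubgroup x y
  have hz1 : z ≠ 1 := fun h => hxy (by
    have : x * y = y * x * z := by rw [hz]; group
    rw [this, h, mul_one])
  -- Conjugation by `y` fixes the square `x ^ 2` and sends `x` to `x * z` with `z` commuting with
  -- `x`; so `x ^ 2 = x ^ 2 * z ^ 2`.
  have hzz : z ^ 2 = 1 := by
    have h1 : y⁻¹ * x * y = x * z := by rw [hz]; group
    have h3 : y⁻¹ * x ^ 2 * y = (x * z) ^ 2 := by rw [← h1, pow_two, pow_two]; group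
    have h4 : y⁻¹ * x ^ 2 * y = x ^ 2 := by
      rw [mul_assoc, hcy _ (sq_mem_squareSubgroup x), inv_mul_cancel_left]
    have hc : Commute x z := (hcx z hzsq).symm
    rw [h4, hc.mul_pow] at h3
    exact left_eq_mul.1 h3
  obtain ⟨χ, hχ⟩ := exists_character_apply_eq_neg_one (K := K) (A := A)
    (fun a b => Subtype.ext (hA a a.2 b b.2)) (mul_ne_zero two_ne_zero hn)
    (fun a => Subtype.ext (by simpa using he a)) hζ (z := ⟨z, hsqA hzsq⟩)
    (fun h => hz1 (congrArg Subtype.val h)) (Subtype.ext (by simpa using hzz))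
  obtain ⟨m, hm0, hm⟩ := exists_eigenvector (H.subtype.comp A.subtype)
    (H.subtype_injective.comp A.subtype_injective) χ
  have hm' : ∀ a (ha : a ∈ A), (a : M ≃ₐ[K] M) m = (χ ⟨a, ha⟩ : K) • m := fun a ha => hm ⟨a, ha⟩
  have hy2A : y ^ 2 ∈ A := hsqA (sq_mem_squareSubgroup y)
  -- `χ(y²)` is an `n`-th root of unity because `y ^ (2 * n) = 1`, so it is a power of `ζ ^ 2`. The
  -- root of unity of full order `2 * n` is needed for its square root.
  obtain ⟨w, hw⟩ : ∃ w : K, w ^ 2 = χ ⟨y ^ 2, hy2A⟩ := by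
    have hζ2 : IsPrimitiveRoot (ζ ^ 2) n := hζ.pow (by positivity) rfl
    have : NeZero n := ⟨hn⟩
    have h1 : ((χ ⟨y ^ 2, hy2A⟩ : Kˣ) : K) ^ n = 1 := by
      rw [← Units.val_pow_eq_pow_val, ← map_pow]
      have : (⟨y ^ 2, hy2A⟩ : A) ^ n = 1 := Subtype.ext (by simpa [← pow_mul] using he y)
      rw [this, map_one, Units.val_one]
    obtain ⟨k, -, hk⟩ := hζ2.eq_pow_of_pow_eq_one h1
    exact ⟨ζ ^ k, by rw [← hk, ← pow_mul, ← pow_mul, mul_comm]⟩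
  have hw0 : w ≠ 0 := by
    rintro rfl
    exact (χ ⟨y ^ 2, hy2A⟩).ne_zero (by rw [← hw]; simp)
  set N : Subgroup (M ≃ₐ[K] M) := (squareSubgroup H).map H.subtype with hN
  have hym0 : (y : M ≃ₐ[K] M) m ≠ 0 := (map_ne_zero _).2 hm0
  -- The element `c` is `w⁻¹ y(m) / m`. Squares commute with `y` and fix it, `χ(z) = -1` gives `x c
  -- = -c`, and `c · y c = w⁻² y²(m) / m = 1`.
  have hdiv : ∀ (a : M ≃ₐ[K] M) (k l : K), k ≠ 0 → a ((y : M ≃ₐ[K] M) m) = l • (y : M ≃ₐ[K] M) m →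
      a m = k • m → a (w⁻¹ • ((y : M ≃ₐ[K] M) m / m)) =
        (l / k) • w⁻¹ • ((y : M ≃ₐ[K] M) m / m) := fun a k l hk h1 h3 => by
    have hk' : algebraMap K M k ≠ 0 := (map_ne_zero _).2 hk
    rw [map_smul, map_div₀, h1, h3, smul_comm]
    congr 1
    rw [Algebra.smul_def, Algebra.smul_def, Algebra.smul_def, map_div₀]
    field_simp
  have hcN : w⁻¹ • ((y : M ≃ₐ[K] M) m / m) ∈ fixedSubmodule N := by
    rintro _ ⟨g, hg, rfl⟩
    have h1 := hm' g (hsqA hg)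
    have := hdiv (g : M ≃ₐ[K] M) _ _ (χ ⟨g, hsqA hg⟩).ne_zero (by
      rw [← AlgEquiv.mul_apply, ← Subgroup.coe_mul, hcy g hg, Subgroup.coe_mul, AlgEquiv.mul_apply,
        h1, map_smul]) h1
    rw [Subgroup.coe_subtype, this, div_self (χ ⟨g, hsqA hg⟩).ne_zero, one_smul]
  have hxc : (x : M ≃ₐ[K] M) (w⁻¹ • ((y : M ≃ₐ[K] M) m / m)) =
      -(w⁻¹ • ((y : M ≃ₐ[K] M) m / m)) := by
    have h1 := hm' x hxA
    have h3 := hm' z (hsqA hzsq)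
    rw [hχ] at h3
    have h4 : x * y = y * (x * z) := by rw [hz]; group
    have := hdiv (x : M ≃ₐ[K] M) _ (-(χ ⟨x, hxA⟩ : K)) (χ ⟨x, hxA⟩).ne_zero (by
      rw [← AlgEquiv.mul_apply, ← Subgroup.coe_mul, h4, Subgroup.coe_mul, Subgroup.coe_mul,
        AlgEquiv.mul_apply, AlgEquiv.mul_apply, h3, map_smul, h1, map_smul, map_smul]
      simp) h1
    rw [this, neg_div, div_self (χ ⟨x, hxA⟩).ne_zero, neg_one_smul]
  have hyc : w⁻¹ • ((y : M ≃ₐ[K] M) m / m) *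
      (y : M ≃ₐ[K] M) (w⁻¹ • ((y : M ≃ₐ[K] M) m / m)) = 1 := by
    have h1 := hm' (y ^ 2) hy2A
    rw [← hw, pow_two, Subgroup.coe_mul, AlgEquiv.mul_apply] at h1
    have hw' : algebraMap K M w ≠ 0 := (map_ne_zero _).2 hw0
    rw [map_smul, map_div₀, h1]
    simp only [Algebra.smul_def, map_inv₀, map_pow]
    field_simp
  have hmemN : ∀ g ∈ squareSubgroup H, (g : M ≃ₐ[K] M) ∈ N := fun g hg => ⟨g, hg, rfl⟩
  obtain ⟨U, hUN, hU, hUdim⟩ := exists_lagrangian_fixedSubmodule h2 hj (N := N)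
    (x := (x : M ≃ₐ[K] M)) (y := (y : M ≃ₐ[K] M))
    (by rintro _ ⟨g, hg, rfl⟩; exact congrArg Subtype.val (hcx g hg))
    (by rintro _ ⟨g, hg, rfl⟩; exact congrArg Subtype.val (hcy g hg))
    (hmemN _ (sq_mem_squareSubgroup x)) (hmemN _ (sq_mem_squareSubgroup y)) (hmemN _ hzsq)
    hcN hxc hyc
  obtain ⟨-, W, -, hW, hWN, hWdim⟩ := isMetabolicStep_map_squareSubgroup h2 hj hp H
  -- A Lagrangian of `M^N` together with one of its orthogonal complement.
  refine ⟨W ⊔ U, ?_, ?_⟩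
  · intro a ha b hb
    obtain ⟨p, hp, q, hq, rfl⟩ := Submodule.mem_sup.1 ha
    obtain ⟨p', hp', q', hq', rfl⟩ := Submodule.mem_sup.1 hb
    have h1 := hWN p' hp' q (hUN hq)
    rw [mul_comm] at h1
    simp [add_mul, mul_add, hW p hp p' hp', hWN p hp q' (hUN hq'), h1, hU q hq q' hq']
  · have hinf : W ⊓ U = ⊥ := by
      rw [eq_bot_iff]
      rintro a ⟨ha, ha'⟩
      exact eq_zero_of_forall_trace_mul_eq_zero h2 hp (hUN ha') (hWN a ha)
    have := Submodule.finrank_sup_add_finrank_inf_eq W U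
    rw [hinf, finrank_bot] at this
    rw [fixedSubmodule_bot, finrank_top, ← hN] at hWdim
    omega

end MinimalNonabelian

/-! ### Non-abelian subgroups and their exponents. -/

section NonabelianSubgroups

variable {G : Type*} [Group G]

theorem exists_minimal_nonabelian_subgroup [Finite G] {H₀ : Subgroup G}
    (h₀ : ∃ x ∈ H₀, ∃ y ∈ H₀, x * y ≠ y * x) :
    ∃ H ≤ H₀, (∃ x y : H, x * y ≠ y * x) ∧
      ∀ S : Subgroup H, S ≠ ⊤ → ∀ a ∈ S, ∀ b ∈ S, a * b = b * a := by
  obtain ⟨H, hH, hmin⟩ := (Set.toFinite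
    {H : Subgroup G | ∃ x ∈ H, ∃ y ∈ H, x * y ≠ y * x}).exists_le_minimal h₀
  obtain ⟨x, hx, y, hy, hxy⟩ := hmin.1
  refine ⟨H, hH, ⟨⟨x, hx⟩, ⟨y, hy⟩, fun h => hxy (congrArg Subtype.val h)⟩, ?_⟩
  intro S hS a ha b hb
  by_contra hab
  refine hS (Subgroup.map_injective H.subtype_injective
    (le_antisymm (Subgroup.map_mono le_top) ?_))
  rw [← MonoidHom.range_eq_map, Subgroup.range_subtype]
  exact hmin.2 ⟨a, ⟨a, ha, rfl⟩, b, ⟨b, hb, rfl⟩, fun h => hab (Subtype.ext h)⟩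
    (Subgroup.map_subtype_le S)

/-- A group in which every square is trivial is abelian, so some element of `H` has order divisible
by four. This is what puts a square root of `-1` into `K`. -/
theorem four_dvd_of_pow_eq_one (hG : IsPGroup 2 G) {H : Subgroup G}
    (hH : ∃ x ∈ H, ∃ y ∈ H, x * y ≠ y * x) {e : ℕ} (he : ∀ h ∈ H, h ^ e = 1) : 4 ∣ e := by
  have : Fact (Nat.Prime 2) := ⟨Nat.prime_two⟩
  obtain ⟨x, hx, y, hy, hxy⟩ := hH
  obtain ⟨h, hh, h2⟩ : ∃ h ∈ H, h ^ 2 ≠ 1 := by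
    by_contra! hc
    have hinv : ∀ h ∈ H, h⁻¹ = h := fun h hh => by
      rw [inv_eq_iff_mul_eq_one, ← pow_two, hc h hh]
    apply hxy
    rw [← hinv _ (mul_mem hx hy), mul_inv_rev, hinv x hx, hinv y hy]
  obtain ⟨k, hk⟩ := IsPGroup.iff_orderOf.1 hG h
  have hk2 : 2 ≤ k := by
    by_contra! hlt
    refine h2 (orderOf_dvd_iff_pow_eq_one.1 ?_)
    rw [hk]
    exact pow_dvd_pow 2 (n := 1) (by omega)
  exact ((pow_dvd_pow 2 hk2).trans (hk ▸ dvd_rfl)).trans (orderOf_dvd_of_pow_eq_one (he h hh))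

theorem exists_exponent_eq_minNonabelianExponent (hG : ∃ x y : G, x * y ≠ y * x) :
    ∃ H : Subgroup G, (∃ x ∈ H, ∃ y ∈ H, x * y ≠ y * x) ∧
      Monoid.exponent H = minNonabelianExponent G := by
  obtain ⟨x, y, hxy⟩ := hG
  exact Nat.sInf_mem (s := {e : ℕ | ∃ H : Subgroup G, (∃ x ∈ H, ∃ y ∈ H, x * y ≠ y * x) ∧
    Monoid.exponent H = e}) ⟨_, ⊤, ⟨x, trivial, y, trivial, hxy⟩, rfl⟩

end NonabelianSubgroups

theorem IsPrimitiveRoot.pow_eq_neg_one {K : Type*} [Field K] {ζ : K} {n : ℕ} (hn : n ≠ 0)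
    (hζ : IsPrimitiveRoot ζ (2 * n)) : ζ ^ n = -1 := by
  have h : ζ ^ n * ζ ^ n = 1 := by rw [← pow_add, ← two_mul, hζ.pow_eq_one]
  exact (mul_self_eq_one_iff.1 h).resolve_left
    (hζ.pow_ne_one_of_pos_of_lt hn (by omega))

theorem IsPrimitiveRoot.two_ne_zero_of_even {K : Type*} [Field K] {ζ : K} {n : ℕ} (hn : n ≠ 0)
    (hζ : IsPrimitiveRoot ζ (2 * n)) : (2 : K) ≠ 0 := fun h2 => by
  refine hζ.pow_ne_one_of_pos_of_lt hn (by omega) ?_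
  rw [hζ.pow_eq_neg_one hn]
  linear_combination -h2

/-! ### Sign changes of the square roots. -/

section SquareRoots

variable {K L : Type*} [Field K] [Field L] [Algebra K L] [IsGalois K L] {r : ℕ}

/-- An automorphism is determined by its signs on the `s i`, and there are `2 ^ r` automorphisms, so
every sign pattern occurs. -/
theorem exists_algEquiv_flip {a : Fin r → Kˣ} {s : Fin r → L}
    (hs : ∀ i, s i ^ 2 = algebraMap K L (a i)) (htop : IntermediateField.adjoin K (Set.range s) = ⊤)
    (hdeg : finrank K L = 2 ^ r) (i : Fin r) :
    ∃ σ : L ≃ₐ[K] L, σ (s i) = -s i ∧ ∀ k ≠ i, σ (s k) = s k := by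
  classical
  have : FiniteDimensional K L := FiniteDimensional.of_finrank_pos (by rw [hdeg]; positivity)
  have : Fintype (L ≃ₐ[K] L) := Fintype.ofFinite _
  have hpm : ∀ (σ : L ≃ₐ[K] L) k, σ (s k) = s k ∨ σ (s k) = -s k := fun σ k => by
    apply sq_eq_sq_iff_eq_or_eq_neg.1
    rw [← map_pow, hs, AlgEquiv.commutes]
  let θ : (L ≃ₐ[K] L) → (Fin r → Bool) := fun σ k => decide (σ (s k) = s k)
  have hθ : Function.Injective θ := by
    intro σ τ h
    have h1 : ∀ k, σ (s k) = τ (s k) := fun k => by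
      have h2 : (σ (s k) = s k) ↔ (τ (s k) = s k) := by simpa [θ] using congrFun h k
      rcases hpm σ k with h3 | h3
      · rw [h3, h2.1 h3]
      · rcases hpm τ k with h4 | h4
        · rw [h4, h2.2 h4]
        · rw [h3, h4]
    refine AlgEquiv.ext fun x => ?_
    have hx : x ∈ IntermediateField.adjoin K (Set.range s) := htop ▸ IntermediateField.mem_top
    induction hx using IntermediateField.adjoin_induction with
    | mem _ h => obtain ⟨k, rfl⟩ := h; exact h1 k
    | algebraMap x => rw [AlgEquiv.commutes, AlgEquiv.commutes]
    | add x y _ _ hx hy => rw [map_add, map_add, hx, hy]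
    | inv x _ hx => rw [map_inv₀, map_inv₀, hx]
    | mul x y _ _ hx hy => rw [map_mul, map_mul, hx, hy]
  have hcard : Fintype.card (L ≃ₐ[K] L) = Fintype.card (Fin r → Bool) := by
    rw [← Nat.card_eq_fintype_card, IsGalois.card_aut_eq_finrank, hdeg]
    simp
  obtain ⟨σ, hσ⟩ := ((Fintype.bijective_iff_injective_and_card θ).2 ⟨hθ, hcard⟩).2
    (fun k => decide (k ≠ i))
  have hσ' : ∀ k, σ (s k) = s k ↔ k ≠ i := fun k => by
    have h := congrFun hσ k
    simp only [θ, decide_eq_decide] at h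
    exact h
  exact ⟨σ, (hpm σ i).resolve_left fun h => (hσ' i).1 h rfl, fun k hk => (hσ' k).2 hk⟩

end SquareRoots

/-! ### `L` as the fixed field of the Frattini subgroup. -/

section FrattiniExtension

variable {K M : Type*} [Field K] [Field M] [Algebra K M] [FiniteDimensional K M] [IsGalois K M]

theorem isMetabolicStep_squareSubgroup (h2 : (2 : K) ≠ 0) {j : K} (hj : j ^ 2 = -1)
    (hp : IsPGroup 2 (M ≃ₐ[K] M)) : IsMetabolicStep ⊥ (squareSubgroup (M ≃ₐ[K] M)) :=
  rel_bot_squareSubgroup hp IsMetabolicStep (fun _ => IsMetabolicStep.refl _)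
    (fun _ _ _ => IsMetabolicStep.trans h2 hp) (fun _ _ _ h => h.isMetabolicStep h2 hj)

theorem mem_fixedSubmodule_squareSubgroup_iff {L : Type*} [Field L] [Algebra K L] [IsGalois K L]
    [Algebra L M] [IsScalarTower K L M] {G : Type*} [Group G] [Finite G] (hG : IsPGroup 2 G)
    (φ : (L ≃ₐ[K] L) ≃* G ⧸ frattini G) (ψ : (M ≃ₐ[K] M) ≃* G)
    (hψ : ∀ σ : M ≃ₐ[K] M, φ (AlgEquiv.restrictNormalHom L σ) = (ψ σ : G ⧸ frattini G)) {m : M} :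
    m ∈ fixedSubmodule (squareSubgroup (M ≃ₐ[K] M)) ↔ ∃ l : L, algebraMap L M l = m := by
  have hmem : ∀ σ : M ≃ₐ[K] M, σ ∈ squareSubgroup (M ≃ₐ[K] M) ↔
      AlgEquiv.restrictNormalHom L σ = 1 := fun σ => by
    rw [← map_eq_one_iff φ φ.injective, hψ, QuotientGroup.eq_one_iff,
      hG.frattini_eq_squareSubgroup,
      ← map_squareSubgroup_of_surjective (ψ : (M ≃ₐ[K] M) →* G) ψ.surjective]
    exact (Subgroup.mem_map_iff_mem (f := (ψ : (M ≃ₐ[K] M) →* G)) ψ.injective).symm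
  have hres : ∀ (σ : M ≃ₐ[K] M) (l : L),
      algebraMap L M (AlgEquiv.restrictNormalHom L σ l) = σ (algebraMap L M l) := fun σ l =>
    AlgEquiv.restrictNormal_commutes σ L l
  constructor
  · intro hm
    have h : m ∈ IntermediateField.fixedField
        (IntermediateField.fixingSubgroup (IsScalarTower.toAlgHom K L M).fieldRange) := by
      rintro ⟨σ, hσ⟩
      refine hm σ ((hmem σ).2 (AlgEquiv.ext fun l => (algebraMap L M).injective ?_))
      rw [hres]
      exact (IntermediateField.mem_fixingSubgroup_iff _ _).1 hσ _ ⟨l, rfl⟩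
    rw [IsGalois.fixedField_fixingSubgroup] at h
    exact h
  · rintro ⟨l, rfl⟩ σ hσ
    rw [← hres, (hmem σ).1 hσ, AlgEquiv.one_apply]

end FrattiniExtension

/-! ### The Pfister form in coordinates. -/

section Pfister

variable {K : Type*} [Field K] {r : ℕ}

theorem pfisterForm_apply (a : Fin r → Kˣ) (v : (Fin r → Fin 2) → K) :
    pfisterForm a v = ∑ ε, (∏ i, (![1, -(a i : K)] : Fin 2 → K) (ε i)) * (v ε * v ε) := by
  simp [pfisterForm, QuadraticMap.weightedSumSquares_apply]

theorem pfisterForm_coeff_ne_zero (a : Fin r → Kˣ) (ε : Fin r → Fin 2) :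
    ∏ i, (![1, -(a i : K)] : Fin 2 → K) (ε i) ≠ 0 := by
  refine Finset.prod_ne_zero_iff.2 fun i _ => ?_
  generalize ε i = k
  fin_cases k <;> simp

theorem pfisterForm_polar (a : Fin r → Kˣ) (v w : (Fin r → Fin 2) → K) :
    QuadraticMap.polar (pfisterForm a) v w =
      ∑ ε, 2 * (∏ i, (![1, -(a i : K)] : Fin 2 → K) (ε i)) * (v ε * w ε) := by
  rw [QuadraticMap.polar, pfisterForm_apply, pfisterForm_apply, pfisterForm_apply,
    ← Finset.sum_sub_distrib, ← Finset.sum_sub_distrib]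
  refine Finset.sum_congr rfl fun ε _ => ?_
  rw [Pi.add_apply]
  ring

theorem pfisterForm_polarBilin_nondegenerate (h2 : (2 : K) ≠ 0) (a : Fin r → Kˣ) :
    (QuadraticMap.polarBilin (pfisterForm a)).Nondegenerate := by
  have h : ∀ v : (Fin r → Fin 2) → K,
      (∀ w, QuadraticMap.polar (pfisterForm a) v w = 0) → v = 0 := fun v hv => by
    funext ε
    have := hv (Pi.single ε 1)
    rw [pfisterForm_polar, Finset.sum_eq_single ε (fun ε' _ hne => by simp [hne]) (by simp)] at this
    simpa [h2, pfisterForm_coeff_ne_zero a ε] using this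
  exact ⟨fun v hv => h v hv, fun v hv => h v fun w => by
    rw [QuadraticMap.polar_comm]; exact hv w⟩

end Pfister

/-! ### Square-free monomials as an orthogonal system for the trace form. -/

section Monomials

variable {K M : Type*} [Field K] [Field M] [Algebra K M] {r : ℕ}

/-- The square-free monomial in the `q i` with exponents `ε`. -/
def sqfreeMonomial (q : Fin r → M) (ε : Fin r → Fin 2) : M :=
  ∏ i, (![1, q i] : Fin 2 → M) (ε i)

theorem sqfreeMonomial_mul_self {a : Fin r → Kˣ} {q : Fin r → M}
    (hq : ∀ i, q i ^ 2 = algebraMap K M (-(a i : K))) (ε : Fin r → Fin 2) :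
    sqfreeMonomial q ε * sqfreeMonomial q ε =
      algebraMap K M (∏ i, (![1, -(a i : K)] : Fin 2 → K) (ε i)) := by
  rw [sqfreeMonomial, ← Finset.prod_mul_distrib, map_prod]
  refine Finset.prod_congr rfl fun i _ => ?_
  have := hq i
  generalize ε i = k
  fin_cases k
  · simp
  · simpa [pow_two] using this

theorem trace_sqfreeMonomial_mul_of_ne (h2 : (2 : K) ≠ 0) {q : Fin r → M}
    (hflip : ∀ i, ∃ σ : M ≃ₐ[K] M, σ (q i) = -q i ∧ ∀ k ≠ i, σ (q k) = q k)
    {ε ε' : Fin r → Fin 2} (h : ε ≠ ε') :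
    Algebra.trace K M (sqfreeMonomial q ε * sqfreeMonomial q ε') = 0 := by
  obtain ⟨i, hi⟩ := Function.ne_iff.1 h
  obtain ⟨σ, hσi, hσ⟩ := hflip i
  refine trace_eq_zero_of_neg h2 σ ?_
  rw [sqfreeMonomial, sqfreeMonomial, ← Finset.prod_mul_distrib, map_prod,
    ← Finset.mul_prod_erase _ _ (Finset.mem_univ i), ← Finset.mul_prod_erase _ _ (Finset.mem_univ i),
    ← neg_mul]
  congr 1
  · revert hi
    generalize ε i = k
    generalize ε' i = k'
    fin_cases k <;> fin_cases k' <;> simp [hσi]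
  · refine Finset.prod_congr rfl fun k hk => ?_
    have := hσ k (Finset.ne_of_mem_erase hk)
    generalize ε k = l
    generalize ε' k = l'
    fin_cases l <;> fin_cases l' <;> simp [this]

/-- Distinct monomials are orthogonal, since some automorphism negates their product; the square of
a monomial is the matching Pfister coefficient, whose trace carries the factor `[M : K]`. -/
theorem trace_linearCombination_mul [FiniteDimensional K M] (h2 : (2 : K) ≠ 0) {a : Fin r → Kˣ}
    {q : Fin r → M} (hq : ∀ i, q i ^ 2 = algebraMap K M (-(a i : K)))
    (hflip : ∀ i, ∃ σ : M ≃ₐ[K] M, σ (q i) = -q i ∧ ∀ k ≠ i, σ (q k) = q k)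
    (v w : (Fin r → Fin 2) → K) :
    Algebra.trace K M (Fintype.linearCombination K (sqfreeMonomial q) v *
      Fintype.linearCombination K (sqfreeMonomial q) w) = (finrank K M : K) *
        ∑ ε, (∏ i, (![1, -(a i : K)] : Fin 2 → K) (ε i)) * (v ε * w ε) := by
  rw [Fintype.linearCombination_apply, Fintype.linearCombination_apply, Finset.sum_mul_sum, map_sum,
    Finset.mul_sum]
  refine Finset.sum_congr rfl fun ε _ => ?_
  rw [map_sum, Finset.sum_eq_single ε]
  · rw [smul_mul_smul_comm, sqfreeMonomial_mul_self hq, map_smul, Algebra.trace_algebraMap,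
      smul_eq_mul, nsmul_eq_mul]
    ring
  · intro ε' _ hne
    rw [smul_mul_smul_comm, map_smul, trace_sqfreeMonomial_mul_of_ne h2 hflip hne.symm, smul_zero]
  · simp

end Monomials

/-! ### Descent of the Lagrangian from `M` to `L`. -/

theorem proposition8p3 {G : Type u₁} [Group G] [Finite G]
    (hG : IsPGroup 2 G) (hGna : ∃ x y : G, x * y ≠ y * x)
    (r : ℕ) (hr : frattiniRank G = r)
    (K : Type u₂) (L : Type u₃) [Field K] [Field L] [Algebra K L] [IsGalois K L]
    (a : Fin r → Kˣ) (hL : IsGeneratedBySqrts K L a) (hdeg : Module.finrank K L = 2 ^ r)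
    (φ : (L ≃ₐ[K] L) ≃* G ⧸ frattini G)
    (hζ : ∃ ζ : K, IsPrimitiveRoot ζ (minNonabelianExponent G))
    (hsol : ExtensionProblemSolvable.{u₁, u₂, u₃, w} (frattini G) K L φ) :
    IsHyperbolicForm (pfisterForm a) := by
  classical
  have : Fact (Nat.Prime 2) := ⟨Nat.prime_two⟩
  obtain ⟨M, _, _, _, _, _, _, ψ, hψ⟩ := hsol
  obtain ⟨ζ, hζ⟩ := hζ
  obtain ⟨s, hs, htop⟩ := hL
  obtain ⟨H₀, hH₀, he⟩ := exists_exponent_eq_minNonabelianExponent hGna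
  have hp : IsPGroup 2 (M ≃ₐ[K] M) := hG.of_equiv ψ.symm
  have hpow : ∀ h ∈ H₀, h ^ minNonabelianExponent G = 1 := fun h hh => by
    rw [← he]
    exact congrArg Subtype.val (Monoid.pow_exponent_eq_one (⟨h, hh⟩ : H₀))
  obtain ⟨n, hn⟩ := four_dvd_of_pow_eq_one hG hH₀ hpow
  have hn0 : n ≠ 0 := by
    rintro rfl
    exact Monoid.exponent_ne_zero_of_finite (G := H₀) (he.trans hn)
  rw [show 4 * n = 2 * (2 * n) by ring] at hn
  rw [hn] at hζ hpow
  have h2n0 : 2 * n ≠ 0 := mul_ne_zero two_ne_zero hn0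
  have h2 : (2 : K) ≠ 0 := hζ.two_ne_zero_of_even h2n0
  have hj : (ζ ^ n) ^ 2 = -1 := by
    rw [← pow_mul, mul_comm]; exact hζ.pow_eq_neg_one h2n0
  set j := ζ ^ n
  -- Minimality is sought below the preimage of `H₀`, so that the exponent of `H` still divides `e`.
  obtain ⟨H, hH, ⟨x, y, hxy⟩, hab⟩ := exists_minimal_nonabelian_subgroup
    (H₀ := H₀.comap (ψ : (M ≃ₐ[K] M) →* G)) (by
      obtain ⟨x, hx, y, hy, hxy⟩ := hH₀
      refine ⟨ψ.symm x, by simpa using hx, ψ.symm y, by simpa using hy, fun h => hxy ?_⟩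
      simpa using congrArg ψ h)
  obtain ⟨U, hU, hUdim⟩ := exists_lagrangian_of_minimal_nonabelian h2 hj hp hab hxy h2n0
    (fun h => Subtype.ext (ψ.injective (by simpa using hpow _ (hH h.2)))) hζ
  obtain ⟨-, W, -, hW, hWN, hWdim⟩ := isMetabolicStep_squareSubgroup h2 hj hp
  set N := fixedSubmodule (squareSubgroup (M ≃ₐ[K] M)) with hN
  rw [fixedSubmodule_bot, finrank_top] at hWdim
  obtain ⟨V, hVN, hV, hVdim⟩ := exists_isotropic_of_isotropic (Algebra.traceForm K M)
    (traceForm_nondegenerate K M) (Algebra.traceForm_isSymm K) hU hUdim hW hWN (by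
      rw [eq_bot_iff]
      rintro m ⟨hm, hmN⟩
      exact eq_zero_of_forall_trace_mul_eq_zero h2 hp hmN (hWN m hm)) hWdim
  have hNL : ∀ m, m ∈ N ↔ ∃ l : L, algebraMap L M l = m := fun m =>
    mem_fixedSubmodule_squareSubgroup_iff hG φ ψ hψ
  have hNdim : finrank K N = 2 ^ r := by
    have : N = LinearMap.range (IsScalarTower.toAlgHom K L M).toLinearMap :=
      Submodule.ext fun m => hNL m
    rw [this, LinearMap.finrank_range_of_inj (algebraMap L M).injective, hdeg]
  -- The factor `j` turns the square `aᵢ` into the Pfister coefficient `-aᵢ`.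
  let q : Fin r → M := fun i => j • algebraMap L M (s i)
  have hq : ∀ i, q i ^ 2 = algebraMap K M (-(a i : K)) := fun i => by
    rw [smul_pow, hj, ← map_pow, hs, ← IsScalarTower.algebraMap_apply, neg_one_smul, map_neg]
  have hqN : ∀ i, q i ∈ N := fun i => N.smul_mem _ ((hNL _).2 ⟨s i, rfl⟩)
  have hflip : ∀ i, ∃ σ : M ≃ₐ[K] M, σ (q i) = -q i ∧ ∀ k ≠ i, σ (q k) = q k := fun i => by
    obtain ⟨τ, hτi, hτ⟩ := exists_algEquiv_flip hs htop hdeg i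
    obtain ⟨σ, rfl⟩ := AlgEquiv.restrictNormalHom_surjective (F := K) (K₁ := L) M τ
    have hres : ∀ l : L, σ (algebraMap L M l) =
        algebraMap L M (AlgEquiv.restrictNormalHom L σ l) := fun l =>
      (AlgEquiv.restrictNormal_commutes σ L l).symm
    refine ⟨σ, ?_, fun k hk => ?_⟩
    · rw [map_smul, hres, hτi, map_neg, smul_neg]
    · rw [map_smul, hres, hτ k hk]
  set Ψ := Fintype.linearCombination K (sqfreeMonomial q) with hΨ
  have htr := trace_linearCombination_mul h2 hq hflip
  have hd : (finrank K M : K) ≠ 0 := by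
    rw [← IsGalois.card_aut_eq_finrank]
    obtain ⟨k, hk⟩ := IsPGroup.iff_card.1 hp
    rw [hk]
    push_cast
    exact pow_ne_zero _ h2
  have hΨinj : Function.Injective Ψ := by
    rw [← LinearMap.ker_eq_bot, LinearMap.ker_eq_bot']
    intro v hv
    refine (pfisterForm_polarBilin_nondegenerate h2 a).1 v fun w => ?_
    have h := htr v w
    rw [← hΨ, hv, zero_mul, map_zero] at h
    have h' := (mul_eq_zero.1 h.symm).resolve_left hd
    rw [QuadraticMap.polarBilin_apply_apply, pfisterForm_polar]
    simp only [mul_assoc]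
    rw [← Finset.mul_sum, h', mul_zero]
  have hrange : LinearMap.range Ψ = N := by
    apply Submodule.eq_of_le_of_finrank_eq
    · rintro _ ⟨v, rfl⟩
      rw [hΨ, Fintype.linearCombination_apply]
      refine N.sum_mem fun ε _ => N.smul_mem _ fun σ hσ => ?_
      rw [sqfreeMonomial, map_prod]
      refine Finset.prod_congr rfl fun i _ => ?_
      have := hqN i σ hσ
      generalize ε i = k
      fin_cases k <;> simp [this]
    · rw [LinearMap.finrank_range_of_inj hΨinj, hNdim]
      simp
  refine isHyperbolicForm_of_isotropic h2 _ (pfisterForm_polarBilin_nondegenerate h2 a)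
    (V.comap Ψ) (fun v hv => ?_) ?_
  · have h := htr v v
    rw [← hΨ, show Algebra.trace K M (Ψ v * Ψ v) = 0 from hV _ hv _ hv, ← pfisterForm_apply] at h
    exact (mul_eq_zero.1 h.symm).resolve_left hd
  · have hmap : (V.comap Ψ).map Ψ = V := by
      rw [Submodule.map_comap_eq, hrange, inf_eq_right.2 hVN]
    have h1 : finrank K (V.comap Ψ) = finrank K V := by
      rw [(Submodule.equivMapOfInjective Ψ hΨinj (V.comap Ψ)).finrank_eq, hmap]
    rw [h1]
    refine le_trans (le_of_eq ?_) hVdim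
    rw [hNdim]
    simp
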